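/- Let $k$ be an algebraically closed field (for example $k=\mathbb{C}$), let $\mathbb{P}^2=\mathrm{Proj}\,k[X,Y,Z]$, and let $s$ be a nonzero global section of the tangent bundle $T_{\mathbb{P}^2}=\mathcal{D}er_k(\mathcal{O}_{\mathbb{P}^2},\mathcal{O}_{\mathbb{P}^2})$. Let $V\subset\mathbb{P}^2$ be the scheme of zeros of $s$, that is, the closed subscheme whose ideal sheaf $\mathcal{I}_V$ is generated by the local components of $s$ (equivalently, by the local functions $s(a)$, where $a$ runs over local sections of $\mathcal{O}_{\mathbb{P}^2}$). Then $V$ is of one of the following types: (a) $V$ consists of three distinct points, each of multiplicity one; (b) $V$ consists of two distinct points, one of multiplicity two and the other of multiplicity one; (c) $V$ consists of a single point of multiplicity three; (d) $V$ is the (scheme-theoretic) union of a line and a reduced closed point not on the line; (e) $V$ is a line with an embedded point on it: there are a line $L$ and a closed point $p\in L$ such that $V$ contains $L$ as a closed subscheme, $V$ and $L$ agree on $\mathbb{P}^2\setminus\{p\}$, $p$ is an embedded point of $V$, and this embedded point is simple, i.e. the kernel $\mathcal{I}_L/\mathcal{I}_V$ of $\mathcal{O}_V\to\mathcal{O}_L$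 has length one. Here the multiplicity of $V$ at a point $x$ in (a)-(c) is the length of the local ring $\mathcal{O}_{V,x}$, a line is the reduced closed subscheme $\ell=0$ for a nonzero linear form $\ell$, and an embedded point of $V$ is a point $x$ such that the maximal ideal of $\mathcal{O}_{V,x}$ is an associated prime, but not a minimal prime, of $\mathcal{O}_{V,x}$. -/

import Mathlib

open CategoryTheory AlgebraicGeometry TopologicalSpace

universe u

noncomputable section

namespace PlaneTangent

/-! ### Sections of the tangent sheaf and their zero schemes -/

/-- The constants in `Γ(X, U)`, for a scheme `X` over a field `k` with structure map `f`. -/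
def constants {k : Type u} [Field k] {X : Scheme.{u}} (f : X ⟶ Spec (CommRingCat.of k))
    (U : X.Opens) : k →+* Γ(X, U) :=
  ((Scheme.ΓSpecIso (CommRingCat.of k)).inv ≫ f.appTop ≫
    X.presheaf.map (homOfLE (le_top : U ≤ ⊤)).op).hom

/-- A global section of the tangent sheaf `T_X = Hom(Ω_{X/k}, 𝒪_X) = Der_k(𝒪_X, 𝒪_X)` of a
`k`-scheme `X`: a `k`-linear derivation of the sheaf `𝒪_X`, that is, a family of derivations of
the rings `Γ(X, U)` that is compatible with restriction. (An additive derivation is `k`-linear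
iff it kills the constants.) -/
@[ext]
structure TangentSection {k : Type u} [Field k] {X : Scheme.{u}}
    (f : X ⟶ Spec (CommRingCat.of k)) where
  der : ∀ U : X.Opens, Derivation ℤ Γ(X, U) Γ(X, U)
  der_constants : ∀ (U : X.Opens) (c : k), der U (constants f U c) = 0
  der_restrict : ∀ (U V : X.Opens) (h : V ≤ U) (a : Γ(X, U)),
    der V ((X.presheaf.map (homOfLE h).op).hom a) =
      (X.presheaf.map (homOfLE h).op).hom (der U a)

namespace TangentSection

variable {k : Type u} [Field k] {X : Scheme.{u}} {f : X ⟶ Spec (CommRingCat.of k)}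

instance : Zero (TangentSection f) where
  zero :=
    { der := fun _ => 0
      der_constants := fun _ _ => rfl
      der_restrict := fun _ _ _ _ => by simp }

theorem map_span_range_der (s : TangentSection f) (U : X.Opens) (hU : IsAffineOpen U)
    (g : Γ(X, U)) :
    (Ideal.span (Set.range (s.der U))).map
        (X.presheaf.map (homOfLE (X.basicOpen_le g)).op).hom =
      Ideal.span (Set.range (s.der (X.basicOpen g))) := by
  let F := X.presheaf.map (homOfLE (X.basicOpen_le g)).op
  apply le_antisymm
  · rw [Ideal.map_le_iff_le_comap, Ideal.span_le]
    rintro _ ⟨a, rfl⟩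
    exact Ideal.subset_span ⟨F.hom a, s.der_restrict _ _ (X.basicOpen_le g) a⟩
  · rw [Ideal.span_le]
    rintro _ ⟨b, rfl⟩
    let : Algebra Γ(X, U) Γ(X, X.basicOpen g) := F.hom.toAlgebra
    have : IsLocalization.Away g Γ(X, X.basicOpen g) :=
      hU.isLocalization_of_eq_basicOpen _ _ rfl
    have key : ∀ a, s.der (X.basicOpen g) (F.hom a) ∈
        (Ideal.span (Set.range (s.der U))).map F.hom := fun a => by
      rw [s.der_restrict _ _ (X.basicOpen_le g) a]
      exact Ideal.mem_map_of_mem _ (Ideal.subset_span ⟨a, rfl⟩)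
    obtain ⟨⟨a, ⟨_, n, rfl⟩⟩, hb⟩ := IsLocalization.surj (Submonoid.powers g) b
    have hb' : b * F.hom (g ^ n) = F.hom a := hb
    have hu : IsUnit (F.hom (g ^ n)) :=
      IsLocalization.map_units Γ(X, X.basicOpen g) (⟨g ^ n, n, rfl⟩ : Submonoid.powers g)
    have h1 := congrArg (s.der (X.basicOpen g)) hb'
    rw [Derivation.leibniz, smul_eq_mul, smul_eq_mul] at h1
    refine (Ideal.unit_mul_mem_iff_mem _ hu).mp ?_
    rw [eq_sub_of_add_eq' h1]
    exact sub_mem (key a) (Ideal.mul_mem_left _ _ (key _))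

/-- The ideal sheaf of the zero scheme of a section `s` of `T_X`: the image of the map
`Ω_{X/k} ⟶ 𝒪_X` that `s` is, i.e. on each affine open `U` the ideal generated by all `s(a)`,
`a ∈ Γ(X, U)`. Where `T_X` is free with basis dual to `dx₁, …, dxₙ`, it is generated by the
components `s(x₁), …, s(xₙ)` of `s`. -/
def zeroIdeal (s : TangentSection f) : X.IdealSheafData where
  ideal U := Ideal.span (Set.range (s.der U.1))
  map_ideal_basicOpen U g := s.map_span_range_der U.1 U.2 g

/-- The zero scheme of a section of the tangent sheaf. -/
def zeroScheme (s : TangentSection f) : Scheme.{u} := s.zeroIdeal.subscheme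

end TangentSection

/-! ### The projective plane -/

section Plane

variable (k : Type u) [Field k]

/-- The grading of `k[X, Y, Z]` by degree. -/
abbrev grading : ℕ → Submodule k (MvPolynomial (Fin 3) k) :=
  MvPolynomial.homogeneousSubmodule (Fin 3) k

instance : GradedAlgebra (grading k) := MvPolynomial.gradedAlgebra

/-- The projective plane `Proj k[X, Y, Z]`. -/
abbrev Plane : Scheme.{u} := Proj (grading k)

/-- The structure map of the projective plane. -/
def planeToSpec : Plane k ⟶ Spec (CommRingCat.of k) :=
  Proj.toSpecZero (grading k) ≫ Spec.map (CommRingCat.ofHom (algebraMap k (grading k 0)))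

variable {k}

/-- The closed set `ℓ = 0` in the plane. -/
def zeroSet (l : MvPolynomial (Fin 3) k) : Closeds (Plane k) :=
  ⟨ProjectiveSpectrum.zeroLocus (grading k) {l},
    ProjectiveSpectrum.isClosed_zeroLocus (grading k) {l}⟩

/-- Lines in the plane, as closed sets: the sets `ℓ = 0` with `ℓ` a nonzero linear form. -/
def IsLine (L : Closeds (Plane k)) : Prop :=
  ∃ l : MvPolynomial (Fin 3) k, l.IsHomogeneous 1 ∧ l ≠ 0 ∧ L = zeroSet l

end Plane

/-! ### The five types -/

/-- The multiplicity of a zero-dimensional scheme at a point: the length of its local ring. -/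
def multiplicity (Z : Scheme.{u}) (x : Z) : ℕ∞ :=
  Module.length (Z.presheaf.stalk x) (Z.presheaf.stalk x)

/-- An embedded point: the maximal ideal of the local ring is an associated prime of that ring
but not a minimal one. -/
def IsEmbeddedPoint (Z : Scheme.{u}) (x : Z) : Prop :=
  IsLocalRing.maximalIdeal (Z.presheaf.stalk x) ∈
      associatedPrimes (Z.presheaf.stalk x) (Z.presheaf.stalk x) ∧
    IsLocalRing.maximalIdeal (Z.presheaf.stalk x) ∉ minimalPrimes (Z.presheaf.stalk x)

/-- Three distinct (reduced) points. -/
def IsThreePoints (Z : Scheme.{u}) : Prop :=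
  ∃ p q r : Z, p ≠ q ∧ p ≠ r ∧ q ≠ r ∧ (∀ x : Z, x = p ∨ x = q ∨ x = r) ∧
    multiplicity Z p = 1 ∧ multiplicity Z q = 1 ∧ multiplicity Z r = 1

/-- Two points, one of multiplicity two and the other of multiplicity one. -/
def IsDoubleAndSimplePoint (Z : Scheme.{u}) : Prop :=
  ∃ p q : Z, p ≠ q ∧ (∀ x : Z, x = p ∨ x = q) ∧ multiplicity Z p = 2 ∧ multiplicity Z q = 1

/-- A single point of multiplicity three. -/
def IsTriplePoint (Z : Scheme.{u}) : Prop :=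
  ∃ p : Z, (∀ x : Z, x = p) ∧ multiplicity Z p = 3

section Types

variable {k : Type u} [Field k]

/-- The closed subscheme of the plane with ideal sheaf `I` is the union of a line and a (reduced)
closed point not on the line. -/
def IsLineUnionPoint (I : (Plane k).IdealSheafData) : Prop :=
  ∃ (L : Closeds (Plane k)) (p : Plane k) (hp : IsClosed ({p} : Set (Plane k))),
    IsLine L ∧ p ∉ L ∧
      I = Scheme.IdealSheafData.vanishingIdeal L ⊓
        Scheme.IdealSheafData.vanishingIdeal ⟨{p}, hp⟩

/-- The closed subscheme `V` of the plane with ideal sheaf `I` is a line `L` with an embedded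
point `p` on it: `V` contains `L` and agrees with it away from the closed point `p ∈ L`,
`p` is an embedded point of `V`, and it is a simple one, that is, the kernel `I_L / I` of
`𝒪_V ⟶ 𝒪_L`, which is supported at `p`, has length one. -/
def IsLineWithEmbeddedPoint (I : (Plane k).IdealSheafData) : Prop :=
  ∃ (L : Closeds (Plane k)) (p : Plane k),
    IsLine L ∧ IsClosed ({p} : Set (Plane k)) ∧ p ∈ L ∧
      I ≤ Scheme.IdealSheafData.vanishingIdeal L ∧
      (∀ U : (Plane k).affineOpens, p ∉ U.1 →
        I.ideal U = (Scheme.IdealSheafData.vanishingIdeal L).ideal U) ∧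
      (∃ x : I.subscheme, I.subschemeι x = p ∧ IsEmbeddedPoint I.subscheme x) ∧
      (∀ U : (Plane k).affineOpens, p ∈ U.1 →
        Module.length Γ(Plane k, U)
          ((Scheme.IdealSheafData.vanishingIdeal L).ideal U ⧸
            (I.ideal U).submoduleOf ((Scheme.IdealSheafData.vanishingIdeal L).ideal U)) = 1)

end Types

end PlaneTangent

end

noncomputable section

namespace PlaneTangent

/-! ### Sections over open sets as elements of `k(X, Y, Z)` -/

variable {k : Type u} [Field k]

/-! By the Euler sequence, vector fields on the plane are endomorphisms `T` of the three-dimensional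
space of linear forms, modulo scalars, acting by `s(m/l) = (l T(m) - m T(l)) / l²`. To obtain `T`
(`exists_endomorphism`), compare `s(X_j/X_i)` with `s(X_i/X_j)`: the former has at most a double
pole along `X_i = 0`, so it is a quadratic form over `X_i²`. The Leibniz rule for `X₂/X₀ =
(X₂/X₁)(X₁/X₀)` makes the three quadratic forms a Koszul cocycle, and `koszul_exact` writes them as
`X_i d_j - X_j d_i` with linear forms `d_i`, which serve as `T(X_i)`.

A scalar `T` gives the zero field, so here `T` is not scalar and has one of five Jordan types
(`exists_jordan_basis`). Take a Jordan basis as homogeneous coordinates. Each chart is an affine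
plane with coordinates `u, v`, and the ideal of `V` there is generated by `s(u)` and `s(v)`
(`zeroIdeal_chart`). Three distinct eigenvalues give the ideal `(u, v)` on every chart. A block of
size two with another eigenvalue gives `k[t]/(t²)` and a reduced point; a block of size three gives
`k[t]/(t³)`. A diagonalizable `T` with a double eigenvalue gives a line and a point off it. A scalar
plus a nilpotent of rank one gives a line that has the ideal `(uv, v²)` near the embedded point.

Two transfers remain. Local rings of `V` are localizations of the chart quotients (`stalkEquiv`),
which yields multiplicities and the embedded point. The length-one condition concerns every affine
neighbourhood of `p`, and `covBy_of_covBy` carries it there from a single chart. -/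

theorem irrelevant_not_le_bot :
    ¬ (HomogeneousIdeal.irrelevant (grading k) ≤ (⊥ : HomogeneousIdeal (grading k))) := by
  intro h
  have hX : (MvPolynomial.X 0 : MvPolynomial (Fin 3) k) ∈
      HomogeneousIdeal.irrelevant (grading k) := by
    rw [HomogeneousIdeal.mem_irrelevant_iff, GradedRing.proj_apply,
      DirectSum.decompose_of_mem_ne (grading k) (i := 1) (j := 0)
        (MvPolynomial.isHomogeneous_X k 0) one_ne_zero]
  exact MvPolynomial.X_ne_zero (R := k) (0 : Fin 3) (h hX)

variable (k) in
/-- The generic point of the projective plane, as a homogeneous prime ideal. -/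
def genericPt : ProjectiveSpectrum (grading k) where
  asHomogeneousIdeal := ⊥
  isPrime := by
    change (⊥ : Ideal (MvPolynomial (Fin 3) k)).IsPrime
    exact Ideal.isPrime_bot
  not_irrelevant_le := irrelevant_not_le_bot

variable (k) in
/-- The field of fractions of the homogeneous coordinate ring of the plane. -/
abbrev Frac : Type u := FractionRing (MvPolynomial (Fin 3) k)

theorem genericPt_primeCompl_le :
    (genericPt k).asHomogeneousIdeal.toIdeal.primeCompl ≤
      (nonZeroDivisors (MvPolynomial (Fin 3) k)).comap (RingHom.id _) := by
  intro x hx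
  exact mem_nonZeroDivisors_of_ne_zero hx

/-- The value at the generic point of a section of `𝒪` over a nonempty open set. -/
def genericValue (U : (Plane k).Opens) (hU : genericPt k ∈ U) : Γ(Plane k, U) →+* Frac k :=
  ((IsLocalization.map (Frac k) (RingHom.id _) (genericPt_primeCompl_le (k := k))).comp
    (algebraMap (HomogeneousLocalization.AtPrime (grading k)
      (genericPt k).asHomogeneousIdeal.toIdeal)
      (Localization (genericPt k).asHomogeneousIdeal.toIdeal.primeCompl))).comp
    (openToLocalization (grading k) U (genericPt k) hU).hom

/-- Sections are functions on points and restriction keeps their values, hence `rfl`. -/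
theorem genericValue_res {U V : (Plane k).Opens} (h : V ≤ U) (hV : genericPt k ∈ V)
    (a : Γ(Plane k, U)) :
    genericValue V hV (((Plane k).presheaf.map (homOfLE h).op).hom a) =
      genericValue U (h hV) a := rfl

theorem genericPt_mem_basicOpen {f : MvPolynomial (Fin 3) k} (hf : f ≠ 0) :
    genericPt k ∈ Proj.basicOpen (grading k) f := hf

/-- The section `p / f ^ n` over `D₊(f)`. -/
def frac {f : MvPolynomial (Fin 3) k} {d : ℕ} (hf : f ∈ grading k d) (n : ℕ)
    (p : MvPolynomial (Fin 3) k) (hp : p ∈ grading k (n • d)) :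
    Γ(Plane k, Proj.basicOpen (grading k) f) :=
  (Proj.awayToSection (grading k) f).hom (HomogeneousLocalization.Away.mk (grading k) hf n p hp)

theorem exists_eq_frac {f : MvPolynomial (Fin 3) k} {d : ℕ} (hf : f ∈ grading k d) (hd : 0 < d)
    (a : Γ(Plane k, Proj.basicOpen (grading k) f)) :
    ∃ n p hp, a = frac hf n p hp := by
  let e := Proj.basicOpenIsoAway (grading k) f hf hd
  obtain ⟨n, p, hp, h⟩ := HomogeneousLocalization.Away.mk_surjective (grading k) hf (e.inv.hom a)
  refine ⟨n, p, hp, ?_⟩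
  rw [frac, h]
  exact (congr($(e.inv_hom_id).hom a)).symm

theorem genericValue_frac_mul {f : MvPolynomial (Fin 3) k} (hf0 : f ≠ 0) {d : ℕ}
    (hf : f ∈ grading k d) (n : ℕ) (p : MvPolynomial (Fin 3) k) (hp : p ∈ grading k (n • d)) :
    genericValue _ (genericPt_mem_basicOpen hf0) (frac hf n p hp) * algebraMap _ _ f ^ n =
      algebraMap _ (Frac k) p := by
  have h := ProjectiveSpectrum.Proj.awayToSection_apply (grading k) f
    (HomogeneousLocalization.Away.mk (grading k) hf n p hp) ⟨genericPt k, hf0⟩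
  rw [HomogeneousLocalization.Away.val_mk, Localization.mk_eq_mk', IsLocalization.map_mk'] at h
  change IsLocalization.map (Frac k) (RingHom.id _) (genericPt_primeCompl_le (k := k))
    (HomogeneousLocalization.val
      (((ProjectiveSpectrum.Proj.awayToSection (grading k) f).hom'
        (HomogeneousLocalization.Away.mk (grading k) hf n p hp)).1 ⟨genericPt k, hf0⟩)) * _ = _
  rw [h, IsLocalization.map_mk', ← map_pow]
  exact IsLocalization.mk'_spec _ _ _

theorem genericValue_injective {f : MvPolynomial (Fin 3) k} (hf0 : f ≠ 0) {d : ℕ}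
    (hf : f ∈ grading k d) (hd : 0 < d) :
    Function.Injective (genericValue (Proj.basicOpen (grading k) f)
      (genericPt_mem_basicOpen hf0)) := by
  rw [injective_iff_map_eq_zero]
  intro a ha
  obtain ⟨n, p, hp, rfl⟩ := exists_eq_frac hf hd a
  have h := genericValue_frac_mul hf0 hf n p hp
  rw [ha, zero_mul] at h
  have hp0 : p = 0 := by
    rw [eq_comm, ← (algebraMap (MvPolynomial (Fin 3) k) (Frac k)).map_zero] at h
    exact IsFractionRing.injective _ _ h
  subst hp0
  have : HomogeneousLocalization.Away.mk (grading k) hf n 0 hp = 0 := by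
    apply HomogeneousLocalization.val_injective
    rw [HomogeneousLocalization.Away.val_mk, Localization.mk_zero, HomogeneousLocalization.val_zero]
  rw [frac, this, map_zero]

/-- Links two descriptions of constants: `constants` comes from the structure morphism through
global sections, while computations on `D₊(f)` take place in the homogeneous localization. -/
theorem constants_basicOpen {f : MvPolynomial (Fin 3) k} {d : ℕ} (hf : f ∈ grading k d)
    (hd : 0 < d) :
    CommRingCat.ofHom (constants (planeToSpec k) (Proj.basicOpen (grading k) f)) =
      CommRingCat.ofHom (algebraMap k (grading k 0)) ≫
      CommRingCat.ofHom (HomogeneousLocalization.fromZeroRingHom (grading k) (Submonoid.powers f)) ≫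
        Proj.awayToSection (grading k) f := by
  have h1 : (Proj.basicOpen (grading k) f).ι ≫ planeToSpec k = Proj.basicOpenToSpec (grading k) f ≫
      Spec.map (CommRingCat.ofHom (HomogeneousLocalization.fromZeroRingHom (grading k) _)) ≫
      Spec.map (CommRingCat.ofHom (algebraMap k (grading k 0))) := by
    rw [← Proj.awayι_toSpecZero_assoc (grading k) f hf hd, Proj.awayι,
      ← Proj.basicOpenIsoSpec_hom (grading k) f hf hd]
    simp [planeToSpec]
  have h2 := congr(Scheme.Hom.appTop $h1)
  rw [← Spec.map_comp, Scheme.Hom.comp_appTop, Scheme.Hom.comp_appTop] at h2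
  have h3 := Proj.basicOpenToSpec_app_top (grading k) f
  rw [Scheme.Hom.appTop, Scheme.Hom.appTop, Scheme.Hom.appTop, Scheme.Hom.appTop] at h2
  rw [h3] at h2
  have h4 : Scheme.Hom.app (Proj.basicOpen (grading k) f).ι ⊤ ≫
      (Proj.basicOpen (grading k) f).topIso.hom = (Plane k).presheaf.map
        (homOfLE (le_top : Proj.basicOpen (grading k) f ≤ ⊤)).op := by
    rw [Scheme.Opens.ι_app, Scheme.Opens.topIso_hom]
    exact ((Plane k).presheaf.map_comp _ _).symm
  have h5 := Scheme.ΓSpecIso_naturality (CommRingCat.ofHom (algebraMap k (grading k 0)) ≫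
    CommRingCat.ofHom (HomogeneousLocalization.fromZeroRingHom (grading k) (Submonoid.powers f)))
  ext c
  let x := (Scheme.ΓSpecIso (CommRingCat.of k)).inv.hom c
  let e := (Proj.basicOpen (grading k) f).topIso
  have e1 := congr($(h4).hom ((planeToSpec k).appTop.hom x))
  have e2 := congr(e.hom.hom ($(h2).hom x))
  have e3 := congr($(h5).hom x)
  have e4 := congr($((Scheme.ΓSpecIso (CommRingCat.of k)).inv_hom_id).hom c)
  have e5 : ∀ y, e.hom.hom (e.inv.hom y) = y := fun y => congr($(e.inv_hom_id).hom y)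
  refine (e1.symm.trans e2).trans ((e5 _).trans (congrArg
    (Proj.awayToSection (grading k) f).hom (e3.trans ?_)))
  exact congrArg (HomogeneousLocalization.fromZeroRingHom (grading k) (Submonoid.powers f))
    (congrArg (algebraMap k (grading k 0)) e4)

theorem genericValue_constants (U : (Plane k).Opens) (hU : genericPt k ∈ U) (c : k) :
    genericValue U hU (constants (planeToSpec k) U c) =
      algebraMap (MvPolynomial (Fin 3) k) (Frac k) (MvPolynomial.C c) := by
  have hX : (MvPolynomial.X 0 : MvPolynomial (Fin 3) k) ∈ grading k 1 :=
    MvPolynomial.isHomogeneous_X k 0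
  have hX0 : (MvPolynomial.X 0 : MvPolynomial (Fin 3) k) ≠ 0 := MvPolynomial.X_ne_zero 0
  have h1 : ∀ V (hV : genericPt k ∈ V), genericValue V hV (constants (planeToSpec k) V c) =
      genericValue ⊤ trivial (constants (planeToSpec k) ⊤ c) := by
    intro V hV
    rw [← genericValue_res le_top hV]
    simp [constants]
  -- The value does not depend on the open set, so it may be computed on `D₊(X₀)`, where the
  -- constant is a fraction with denominator `X₀ ^ 0`.
  rw [h1 U hU, ← h1 _ (genericPt_mem_basicOpen hX0)]
  have hc : MvPolynomial.C c ∈ grading k (0 • 1) := by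
    rw [zero_smul]; exact MvPolynomial.isHomogeneous_C _ _
  have h2 : constants (planeToSpec k) (Proj.basicOpen (grading k) (MvPolynomial.X 0)) c =
      frac hX 0 (MvPolynomial.C c) hc := by
    have := congr($(constants_basicOpen hX one_pos).hom c)
    refine this.trans (congrArg (Proj.awayToSection (grading k) (MvPolynomial.X 0)).hom ?_)
    apply HomogeneousLocalization.val_injective
    rw [HomogeneousLocalization.Away.val_mk]
    simp
    rfl
  have h3 := genericValue_frac_mul hX0 hX 0 (MvPolynomial.C c) hc
  rw [h2, ← h3, pow_zero, mul_one]

/-! ### Jordan normal form in dimension three -/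

section NormalForm

variable {k : Type u} [Field k] {V : Type u} [AddCommGroup V] [Module k V]

theorem exists_basis_of_linearIndependent (hV : Module.finrank k V = 3) (v : Fin 3 → V)
    (h : ∀ x y z : k, x • v 0 + y • v 1 + z • v 2 = 0 → x = 0 ∧ y = 0 ∧ z = 0) :
    ∃ b : Module.Basis (Fin 3) k V, ∀ i, b i = v i := by
  have hv : LinearIndependent k v := by
    rw [Fintype.linearIndependent_iff]
    intro g hg i
    rw [Fin.sum_univ_three] at hg
    obtain ⟨h0, h1, h2⟩ := h _ _ _ hg
    fin_cases i <;> assumption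
  exact ⟨basisOfLinearIndependentOfCardEqFinrank hv (by simp [hV]), fun i => by simp⟩

theorem exists_ne_smul_add_smul (hV : Module.finrank k V = 3) (a b : V) :
    ∃ v : V, ∀ p q : k, p • a + q • b ≠ v := by
  classical
  by_contra! h
  have htop : Submodule.span k (({a, b} : Finset V) : Set V) = ⊤ := by
    rw [eq_top_iff]
    intro v _
    obtain ⟨p, q, hpq⟩ := h v
    rw [Finset.coe_pair, Submodule.mem_span_pair]
    exact ⟨p, q, hpq⟩
  have h1 := finrank_span_finset_le_card (R := k) ({a, b} : Finset V)
  rw [Set.finrank, htop, finrank_top, hV] at h1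
  have h2 : ({a, b} : Finset V).card ≤ 2 := Finset.card_le_two
  omega

/-- Two independent vectors and a vector outside their span form a basis. -/
theorem exists_basis_of_notMem (hV : Module.finrank k V = 3) (a b v : V)
    (hab : ∀ p q : k, p • a + q • b = 0 → p = 0 ∧ q = 0)
    (hv : ∀ p q : k, p • a + q • b ≠ v) :
    ∃ B : Module.Basis (Fin 3) k V, B 0 = a ∧ B 1 = v ∧ B 2 = b := by
  obtain ⟨B, hB⟩ := exists_basis_of_linearIndependent hV ![a, v, b] (by
    intro p q r h
    simp only [Matrix.cons_val] at h
    have hq : q = 0 := by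
      by_contra hq
      apply hv (-(q⁻¹ * p)) (-(q⁻¹ * r))
      have h1 : v = q⁻¹ • (q • v) := by rw [smul_smul, inv_mul_cancel₀ hq, one_smul]
      rw [h1]
      linear_combination (norm := module) -(q⁻¹ • h)
    subst hq
    have := hab p r (by simpa using h)
    exact ⟨this.1, rfl, this.2⟩)
  exact ⟨B, hB 0, hB 1, hB 2⟩

/-- Cayley–Hamilton for a split characteristic polynomial, expanded on vectors so that it can enter
linear combinations. -/
theorem exists_roots_charpoly [IsAlgClosed k] (hV : Module.finrank k V = 3)
    (T : Module.End k V) :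
    ∃ x y z : k, T.HasEigenvalue x ∧ T.HasEigenvalue y ∧ T.HasEigenvalue z ∧
      ∀ v, T (T (T v)) - (x + y + z) • T (T v) + (x * y + x * z + y * z) • T v
        - (x * y * z) • v = 0 := by
  have : FiniteDimensional k V := Module.finite_of_finrank_pos (by omega)
  have hs := IsAlgClosed.splits T.charpoly
  have hm := LinearMap.charpoly_monic T
  have hc : T.charpoly.roots.card = 3 := by
    rw [← hs.natDegree_eq_card_roots, LinearMap.charpoly_natDegree, hV]
  obtain ⟨x, y, z, hxyz⟩ := Multiset.card_eq_three.mp hc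
  have hev : ∀ t ∈ T.charpoly.roots, T.HasEigenvalue t := fun t ht =>
    (Module.End.hasEigenvalue_iff_isRoot_charpoly T t).mpr (Polynomial.isRoot_of_mem_roots ht)
  refine ⟨x, y, z, hev _ (by simp [hxyz]), hev _ (by simp [hxyz]), hev _ (by simp [hxyz]),
    fun v => ?_⟩
  have hp := hs.eq_prod_roots_of_monic hm
  rw [hxyz] at hp
  have h0 := LinearMap.aeval_self_charpoly T
  rw [hp] at h0
  have h1 := congr($h0 v)
  simp only [Multiset.insert_eq_cons, Multiset.map_cons, Multiset.map_singleton,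
    Multiset.prod_cons, Multiset.prod_singleton, map_mul, map_sub, Polynomial.aeval_X,
    Polynomial.aeval_C, Module.End.mul_apply, LinearMap.sub_apply,
    Module.algebraMap_end_apply, LinearMap.zero_apply, LinearMap.map_smul] at h1
  rw [← h1]
  module

/-- The five Jordan types of a non-scalar endomorphism of a three-dimensional space. -/
theorem exists_jordan_basis [IsAlgClosed k] (hV : Module.finrank k V = 3) (T : Module.End k V)
    (hT : ¬ ∃ c : k, ∀ v, T v = c • v) :
    ∃ b : Module.Basis (Fin 3) k V,
      (∃ x y z : k, x ≠ y ∧ x ≠ z ∧ y ≠ z ∧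
        T (b 0) = x • b 0 ∧ T (b 1) = y • b 1 ∧ T (b 2) = z • b 2) ∨
      (∃ x y : k, x ≠ y ∧
        T (b 0) = x • b 0 ∧ T (b 1) = x • b 1 + b 0 ∧ T (b 2) = y • b 2) ∨
      (∃ x : k, T (b 0) = x • b 0 ∧ T (b 1) = x • b 1 + b 0 ∧ T (b 2) = x • b 2 + b 1) ∨
      (∃ x y : k, x ≠ y ∧ T (b 0) = x • b 0 ∧ T (b 1) = x • b 1 ∧ T (b 2) = y • b 2) ∨
      (∃ x : k, T (b 0) = x • b 0 ∧ T (b 1) = x • b 1 ∧ T (b 2) = x • b 2 + b 1) := by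
  have : FiniteDimensional k V := Module.finite_of_finrank_pos (by omega)
  obtain ⟨x, y, z, hx, hy, hz, hT3⟩ := exists_roots_charpoly hV T
  -- two distinct eigenvalues, one of them double
  have two : ∀ x y : k, x ≠ y → T.HasEigenvalue x → T.HasEigenvalue y →
      (∀ v, T (T (T v)) - (x + x + y) • T (T v) + (x * x + x * y + x * y) • T v
        - (x * x * y) • v = 0) → ∃ b : Module.Basis (Fin 3) k V,
      (∃ x y : k, x ≠ y ∧
        T (b 0) = x • b 0 ∧ T (b 1) = x • b 1 + b 0 ∧ T (b 2) = y • b 2) ∨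
      (∃ x y : k, x ≠ y ∧ T (b 0) = x • b 0 ∧ T (b 1) = x • b 1 ∧ T (b 2) = y • b 2) := by
    intro x y hxy hx hy h3
    by_cases hq : ∃ v, T (T v) - (x + y) • T v + (x * y) • v ≠ 0
    · obtain ⟨v, hv⟩ := hq
      obtain ⟨f, hf⟩ := hy.exists_hasEigenvector
      have hf1 : T f = y • f := hf.apply_eq_smul
      -- Thus `w = (T - x)(T - y) v ≠ 0`, and Cayley–Hamilton gives `(T - x) w = 0`: `w, e` is a
      -- Jordan chain for `x`.
      set e := T v - y • v with he
      set w := T e - x • e with hw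
      have hw0 : w ≠ 0 := by
        intro h; apply hv; rw [← h, hw, he, map_sub, map_smul]; module
      have hTw : T w = x • w := by
        rw [← sub_eq_zero, ← h3 v, hw, he]
        simp only [map_sub, map_smul]
        module
      have hTe : T e = x • e + w := by rw [hw]; module
      obtain ⟨b, hb⟩ := exists_basis_of_linearIndependent hV ![w, e, f] (by
        intro p q r h
        simp only [Matrix.cons_val] at h
        have h1 := congrArg T h
        simp only [map_add, map_smul, hTw, hTe, hf1, map_zero] at h1
        have h2 := congrArg T h1
        simp only [map_add, map_smul, hTw, hTe, hf1, map_zero] at h2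
        have hxy' : x - y ≠ 0 := sub_ne_zero.mpr hxy
        -- Apply `(T - x)(T - y)` to the relation: it kills `w` and `f` and sends `e` to `(x - y)
        -- w`.
        have hq : (q * (x - y)) • w = 0 := by
          linear_combination (norm := module) h2 - (x + y) • h1 + (x * y) • h
        have hq0 : q = 0 := by simpa [hw0, hxy'] using hq
        subst hq0
        have hr : (r * (y - x)) • f = 0 := by
          linear_combination (norm := module) h1 - x • h
        have hr0 : r = 0 := by simpa [hf.2, sub_ne_zero.mpr hxy.symm] using hr
        subst hr0
        have hp : p = 0 := by simpa [hw0] using h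
        exact ⟨hp, rfl, rfl⟩)
      refine ⟨b, Or.inl ⟨x, y, hxy, ?_⟩⟩
      simp [hb, hTw, hTe, hf1]
    · push Not at hq
      obtain ⟨e, he⟩ := hx.exists_hasEigenvector
      obtain ⟨f, hf⟩ := hy.exists_hasEigenvector
      have he1 : T e = x • e := he.apply_eq_smul
      have hf1 : T f = y • f := hf.apply_eq_smul
      have hxy' : x - y ≠ 0 := sub_ne_zero.mpr hxy
      have hind : ∀ p q : k, p • e + q • f = 0 → p = 0 ∧ q = 0 := by
        intro p q h
        have h1 := congrArg T h
        simp only [map_add, map_smul, he1, hf1, map_zero] at h1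
        have hp : (p * (x - y)) • e = 0 := by
          linear_combination (norm := module) h1 - y • h
        have hq : (q * (y - x)) • f = 0 := by
          linear_combination (norm := module) h1 - x • h
        exact ⟨by simpa [he.2, hxy'] using hp,
          by simpa [hf.2, sub_ne_zero.mpr hxy.symm] using hq⟩
      -- Since `(T - x)(T - y) = 0`, the vectors `(T - y) v` and `(T - x) v` lie in the eigenspaces
      -- of `x` and `y`. They cannot both lie in the span of `e, f`, because their difference is `(x
      -- - y) v`. The one outside is the third eigenvector; which eigenvalue it belongs to need not
      -- be decided.
      obtain ⟨v, hv⟩ := exists_ne_smul_add_smul hV e f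
      have hTx : T (T v - y • v) = x • (T v - y • v) := by
        rw [map_sub, map_smul]
        linear_combination (norm := module) hq v
      have hTy : T (T v - x • v) = y • (T v - x • v) := by
        rw [map_sub, map_smul]
        linear_combination (norm := module) hq v
      by_cases h1 : ∀ p q : k, p • e + q • f ≠ T v - y • v
      · obtain ⟨B, h0, h1, h2⟩ := exists_basis_of_notMem hV e f _ hind h1
        exact ⟨B, Or.inr ⟨x, y, hxy, by rw [h0, he1], by rw [h1, hTx], by rw [h2, hf1]⟩⟩
      by_cases h2 : ∀ p q : k, p • f + q • e ≠ T v - x • v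
      · obtain ⟨B, h0, h1, h2⟩ := exists_basis_of_notMem hV f e _
          (fun p q h => (hind q p (by rw [← h, add_comm])).symm) h2
        exact ⟨B, Or.inr ⟨y, x, hxy.symm, by rw [h0, hf1], by rw [h1, hTy], by rw [h2, he1]⟩⟩
      push Not at h1 h2
      obtain ⟨p, q, h1⟩ := h1
      obtain ⟨p', q', h2⟩ := h2
      refine absurd ?_ (hv ((x - y)⁻¹ * (p - q')) ((x - y)⁻¹ * (q - p')))
      have h3 : v = (x - y)⁻¹ • ((x - y) • v) := by
        rw [smul_smul, inv_mul_cancel₀ hxy', one_smul]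
      rw [h3]
      linear_combination (norm := module) (x - y)⁻¹ • (h1 - h2)
  -- a single eigenvalue
  have one : ∀ x : k, (∀ v, T (T (T v)) - (x + x + x) • T (T v) + (x * x + x * x + x * x) • T v
        - (x * x * x) • v = 0) → ∃ b : Module.Basis (Fin 3) k V,
      (∃ x : k, T (b 0) = x • b 0 ∧ T (b 1) = x • b 1 + b 0 ∧ T (b 2) = x • b 2 + b 1) ∨
      (∃ x : k, T (b 0) = x • b 0 ∧ T (b 1) = x • b 1 ∧ T (b 2) = x • b 2 + b 1) := by
    intro x h3
    by_cases hq : ∃ v, T (T v) - (x + x) • T v + (x * x) • v ≠ 0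
    · obtain ⟨v, hv⟩ := hq
      set e := T v - x • v with he
      set w := T e - x • e with hw
      have hw0 : w ≠ 0 := by
        intro h; apply hv; rw [← h, hw, he, map_sub, map_smul]; module
      have hTw : T w = x • w := by
        rw [← sub_eq_zero, ← h3 v, hw, he]
        simp only [map_sub, map_smul]
        module
      have hTe : T e = x • e + w := by rw [hw]; module
      have hTv : T v = x • v + e := by rw [he]; module
      clear_value w e
      obtain ⟨b, hb⟩ := exists_basis_of_linearIndependent hV ![w, e, v] (by
        intro p q r h
        simp only [Matrix.cons_val] at h
        have h1 := congrArg T h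
        simp only [map_add, map_smul, hTw, hTe, hTv, map_zero] at h1
        have h2 := congrArg T h1
        simp only [map_add, map_smul, hTw, hTe, hTv, map_zero] at h2
        have hr : r • w = 0 := by
          linear_combination (norm := module) h2 - (x + x) • h1 + (x * x) • h
        have hr0 : r = 0 := by simpa [hw0] using hr
        subst hr0
        have hq : q • w = 0 := by
          linear_combination (norm := module) h1 - x • h
        have hq0 : q = 0 := by simpa [hw0] using hq
        subst hq0
        have hp : p = 0 := by simpa [hw0] using h
        exact ⟨hp, rfl, rfl⟩)
      refine ⟨b, Or.inl ⟨x, ?_⟩⟩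
      simp [hb, hTw, hTe, hTv]
    -- Now `N = T - x` satisfies `N² = 0` and `N ≠ 0`. Choose `w = N e ≠ 0`; a vector of `ker N`
    -- that is not a multiple of `w` completes the basis.
    · push Not at hq hT
      obtain ⟨e, he⟩ := hT x
      set w := T e - x • e with hw
      have hw0 : w ≠ 0 := sub_ne_zero.mpr he
      have hTe : T e = x • e + w := by rw [hw]; module
      have hTw : T w = x • w := by
        rw [hw, map_sub, map_smul]
        linear_combination (norm := module) hq e
      clear_value w
      have hind : ∀ p q : k, p • w + q • e = 0 → p = 0 ∧ q = 0 := by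
        intro p q h
        have h1 := congrArg T h
        simp only [map_add, map_smul, hTw, hTe, map_zero] at h1
        have hq : q • w = 0 := by
          linear_combination (norm := module) h1 - x • h
        have hq0 : q = 0 := by simpa [hw0] using hq
        subst hq0
        exact ⟨by simpa [hw0] using h, rfl⟩
      obtain ⟨v, hv⟩ := exists_ne_smul_add_smul hV w e
      have fin : ∀ u : V, T u = x • u → (∀ p : k, p • w ≠ u) → ∃ b : Module.Basis (Fin 3) k V,
          (∃ x : k, T (b 0) = x • b 0 ∧ T (b 1) = x • b 1 ∧ T (b 2) = x • b 2 + b 1) := by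
        intro u hu hpu
        have hu' : ∀ p q : k, p • w + q • e ≠ u := by
          intro p q h
          have h1 := congrArg T h
          simp only [map_add, map_smul, hTw, hTe, hu] at h1
          have hq : q • w = 0 := by
            linear_combination (norm := module) h1 - x • h
          have hq0 : q = 0 := by simpa [hw0] using hq
          subst hq0
          exact hpu p (by simpa using h)
        obtain ⟨B, h0, h1, h2⟩ := exists_basis_of_notMem hV w e u hind hu'
        refine ⟨B.reindex (Equiv.swap 0 1), x, ?_⟩
        have e0 : (Equiv.swap (0 : Fin 3) 1) 2 = 2 := by decide
        simp [h0, h1, h2, hu, hTw, hTe, e0]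
      -- The missing kernel vector is `v - c e` if `N v = c w`, and `N v` itself otherwise.
      by_cases h1 : ∃ c : k, c • w = T v - x • v
      · obtain ⟨c, hc⟩ := h1
        obtain ⟨B, hB⟩ := fin (v - c • e) (by
          rw [map_sub, map_smul, hTe]
          linear_combination (norm := module) -hc) (by
          intro p hp
          exact hv p c (by rw [hp]; module))
        exact ⟨B, Or.inr hB⟩
      · push Not at h1
        obtain ⟨B, hB⟩ := fin (T v - x • v) (by
          rw [map_sub, map_smul]
          linear_combination (norm := module) hq v) h1
        exact ⟨B, Or.inr hB⟩
  by_cases hxy : x = y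
  · subst hxy
    by_cases hxz : x = z
    · subst hxz
      obtain ⟨b, h | h⟩ := one x hT3
      · exact ⟨b, Or.inr (Or.inr (Or.inl h))⟩
      · exact ⟨b, Or.inr (Or.inr (Or.inr (Or.inr h)))⟩
    · obtain ⟨b, h | h⟩ := two x z hxz hx hz hT3
      · exact ⟨b, Or.inr (Or.inl h)⟩
      · exact ⟨b, Or.inr (Or.inr (Or.inr (Or.inl h)))⟩
  by_cases hxz : x = z
  · subst hxz
    obtain ⟨b, h | h⟩ := two x y hxy hx hy (fun v => by
      linear_combination (norm := module) hT3 v)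
    · exact ⟨b, Or.inr (Or.inl h)⟩
    · exact ⟨b, Or.inr (Or.inr (Or.inr (Or.inl h)))⟩
  by_cases hyz : y = z
  · subst hyz
    obtain ⟨b, h | h⟩ := two y x (Ne.symm hxy) hy hx (fun v => by
      linear_combination (norm := module) hT3 v)
    · exact ⟨b, Or.inr (Or.inl h)⟩
    · exact ⟨b, Or.inr (Or.inr (Or.inr (Or.inl h)))⟩
  obtain ⟨e, he⟩ := hx.exists_hasEigenvector
  obtain ⟨f, hf⟩ := hy.exists_hasEigenvector
  obtain ⟨g, hg⟩ := hz.exists_hasEigenvector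
  have he1 : T e = x • e := he.apply_eq_smul
  have hf1 : T f = y • f := hf.apply_eq_smul
  have hg1 : T g = z • g := hg.apply_eq_smul
  obtain ⟨b, hb⟩ := exists_basis_of_linearIndependent hV ![e, f, g] (by
    intro p q r h
    simp only [Matrix.cons_val] at h
    have h1 := congrArg T h
    simp only [map_add, map_smul, he1, hf1, hg1, map_zero] at h1
    have h2 := congrArg T h1
    simp only [map_add, map_smul, he1, hf1, hg1, map_zero] at h2
    -- Applying `(T - y)(T - z)` to the relation isolates `e`; the other two coefficients are
    -- isolated likewise.
    have hp : (p * ((x - y) * (x - z))) • e = 0 := by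
      linear_combination (norm := module) h2 - (y + z) • h1 + (y * z) • h
    have hq : (q * ((y - x) * (y - z))) • f = 0 := by
      linear_combination (norm := module) h2 - (x + z) • h1 + (x * z) • h
    have hr : (r * ((z - x) * (z - y))) • g = 0 := by
      linear_combination (norm := module) h2 - (x + y) • h1 + (x * y) • h
    refine ⟨?_, ?_, ?_⟩
    · simpa [he.2, sub_ne_zero.mpr hxy, sub_ne_zero.mpr hxz] using hp
    · simpa [hf.2, sub_ne_zero.mpr (Ne.symm hxy), sub_ne_zero.mpr hyz] using hq
    · simpa [hg.2, sub_ne_zero.mpr (Ne.symm hxz), sub_ne_zero.mpr (Ne.symm hyz)] using hr)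
  refine ⟨b, Or.inl ⟨x, y, z, hxy, hxz, hyz, ?_⟩⟩
  simp [hb, he1, hf1, hg1]

end NormalForm

/-! ### Koszul exactness for quadratic forms -/

section Koszul

open MvPolynomial

variable {k : Type u} [Field k]

/-- The component of `f * r` in degree `m + d` is `f` times the component of `r` in degree `d`;
cancel `f`. -/
theorem mem_grading_of_mul_mem {f r : MvPolynomial (Fin 3) k} {m d : ℕ} (hf0 : f ≠ 0)
    (hf : f ∈ grading k m) (h : f * r ∈ grading k (m + d)) : r ∈ grading k d := by
  have h1 := DirectSum.coe_decompose_mul_add_of_left_mem (grading k) (i := m) (j := d) (b := r) hf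
  rw [DirectSum.decompose_of_mem_same (grading k) h] at h1
  rw [mul_left_cancel₀ hf0 h1]
  exact SetLike.coe_mem _

theorem X_mem_grading (i : Fin 3) : (X i : MvPolynomial (Fin 3) k) ∈ grading k 1 :=
  isHomogeneous_X k i

theorem X_not_dvd_X_pow {i j : Fin 3} (h : i ≠ j) (n : ℕ) :
    ¬ (X i : MvPolynomial (Fin 3) k) ∣ X j ^ n := by
  intro hd
  have := (MvPolynomial.X_prime (R := k) (i := i)).dvd_of_dvd_pow hd
  rw [MvPolynomial.X_dvd_X] at this
  exact h this

/-- Exactness of the Koszul complex of `X₀, X₁, X₂` in the degree of linear vector fields. -/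
theorem koszul_exact {p q r : MvPolynomial (Fin 3) k} (hp : p ∈ grading k 2)
    (hr : r ∈ grading k 2) (h : X 2 * p + X 0 * q = X 1 * r) :
    ∃ d : Fin 3 → MvPolynomial (Fin 3) k, (∀ i, d i ∈ grading k 1) ∧
      p = X 0 * d 1 - X 1 * d 0 ∧ r = X 0 * d 2 - X 2 * d 0 ∧ q = X 1 * d 2 - X 2 * d 1 := by
  have hmem : p ∈ Ideal.span ({X 0, X 1} : Set (MvPolynomial (Fin 3) k)) := by
    -- Setting `X₀ = X₁ = 0` in the relation leaves `X₂ g(p) = 0`, so `p` lies in the kernel `(X₀,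
    -- X₁)` of this substitution.
    let g : MvPolynomial (Fin 3) k →ₐ[k] MvPolynomial (Fin 3) k := aeval ![0, 0, X 2]
    have hg := congrArg g h
    simp only [map_add, map_mul, g, aeval_X, Matrix.cons_val, zero_mul, add_zero] at hg
    have hgp : g p = 0 := by
      rcases mul_eq_zero.mp hg with h' | h'
      · exact absurd h' (X_ne_zero _)
      · exact h'
    have key : ∀ x, x - g x ∈ Ideal.span ({X 0, X 1} : Set (MvPolynomial (Fin 3) k)) := by
      intro x
      rw [← Ideal.Quotient.mk_eq_mk_iff_sub_mem]
      have : (Ideal.Quotient.mkₐ k (Ideal.span ({X 0, X 1} : Set (MvPolynomial (Fin 3) k)))) =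
          (Ideal.Quotient.mkₐ k (Ideal.span ({X 0, X 1} : Set (MvPolynomial (Fin 3) k)))).comp g := by
        apply MvPolynomial.algHom_ext
        intro i
        rw [AlgHom.comp_apply]
        simp only [g, aeval_X, Ideal.Quotient.mkₐ_eq_mk]
        rw [Ideal.Quotient.mk_eq_mk_iff_sub_mem]
        fin_cases i
        · simpa using Ideal.subset_span (by simp)
        · simpa using Ideal.subset_span (by simp)
        · simp
      exact congr($this x)
    simpa [hgp] using key p
  obtain ⟨a, b, hab⟩ := Ideal.mem_span_pair.mp hmem
  have hX : ∀ i (c : MvPolynomial (Fin 3) k),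
      (DirectSum.decompose (grading k) (c * X i) 2 : MvPolynomial (Fin 3) k) =
      (DirectSum.decompose (grading k) c 1).1 * X i := fun i c =>
    DirectSum.coe_decompose_mul_add_of_right_mem (grading k) (i := 1) (j := 1) (X_mem_grading i)
  -- As `p` is quadratic, the coefficients may be replaced by their linear parts.
  set a' : MvPolynomial (Fin 3) k := (DirectSum.decompose (grading k) a 1).1
  set b' : MvPolynomial (Fin 3) k := (DirectSum.decompose (grading k) b 1).1
  have hab2 : a' * X 0 + b' * X 1 = p := by
    rw [← hX, ← hX, ← Submodule.coe_add, ← DirectSum.add_apply, ← DirectSum.decompose_add, hab]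
    exact DirectSum.decompose_of_mem_same (grading k) hp
  have ha' : a' ∈ grading k 1 := SetLike.coe_mem _
  have hb' : b' ∈ grading k 1 := SetLike.coe_mem _
  have h1 : X 0 * (q + X 2 * a') = X 1 * (r - X 2 * b') := by
    rw [← hab2] at h
    linear_combination h
  obtain ⟨c, hc⟩ : X 0 ∣ r - X 2 * b' := by
    refine ((MvPolynomial.X_prime (R := k) (i := (0 : Fin 3))).dvd_or_dvd ⟨_, h1.symm⟩).resolve_left ?_
    have := X_not_dvd_X_pow (k := k) (i := 0) (j := 1) (by decide) 1
    rwa [pow_one] at this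
  have hc1 : c ∈ grading k 1 := by
    apply mem_grading_of_mul_mem (X_ne_zero 0) (X_mem_grading 0)
    rw [← hc]
    exact sub_mem hr ((isHomogeneous_X k 2).mul hb')
  refine ⟨![-b', a', c], ?_, ?_, ?_, ?_⟩
  · intro i
    fin_cases i
    · exact neg_mem hb'
    · exact ha'
    · exact hc1
  · simp only [Matrix.cons_val]
    rw [← hab2]; ring
  · simp only [Matrix.cons_val]
    linear_combination hc
  · simp only [Matrix.cons_val]
    have h0 : (X 0 : MvPolynomial (Fin 3) k) ≠ 0 := X_ne_zero 0
    apply mul_left_cancel₀ h0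
    linear_combination h1 + X 1 * hc

end Koszul

/-! ### Linear forms as coefficient vectors -/

section LinearForms

open MvPolynomial

variable {k : Type u} [Field k]

/-- The linear form with given coefficients. -/
def lin : (Fin 3 → k) →ₗ[k] MvPolynomial (Fin 3) k := Fintype.linearCombination k X

theorem lin_apply (c : Fin 3 → k) : lin c = ∑ i, C (c i) * X i := by
  simp [lin, Fintype.linearCombination_apply, MvPolynomial.smul_eq_C_mul]

theorem lin_mem (c : Fin 3 → k) : lin c ∈ grading k 1 := by
  rw [lin, Fintype.linearCombination_apply]
  exact sum_mem fun i _ => Submodule.smul_mem _ _ (X_mem_grading i)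

theorem lin_mem' (c : Fin 3 → k) : lin c ∈ grading k (1 • 1) := lin_mem c

theorem lin_single (i : Fin 3) : lin (Pi.single i (1 : k)) = X i := by
  simp [lin]

theorem lin_injective : Function.Injective (lin (k := k)) := by
  exact (MvPolynomial.linearIndependent_X (Fin 3) k).fintypeLinearCombination_injective

theorem lin_ne_zero {c : Fin 3 → k} (hc : c ≠ 0) : lin c ≠ 0 := fun h =>
  hc (lin_injective (by rw [h, map_zero]))

theorem exists_lin_eq {p : MvPolynomial (Fin 3) k} (hp : p ∈ grading k 1) : ∃ c, lin c = p := by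
  have : p ∈ Submodule.span k (Set.range (X (R := k) (σ := Fin 3))) := by
    rwa [← homogeneousSubmodule_one_eq_span_X]
  rw [← Fintype.range_linearCombination] at this
  exact this

end LinearForms

/-! ### Global vector fields and endomorphisms of the linear forms -/

section VectorFields

open MvPolynomial

variable {k : Type u} [Field k]

/-- The value at the generic point of a section over `D₊(f)`. -/
def basicValue {f : MvPolynomial (Fin 3) k} (hf : f ≠ 0) :
    Γ(Plane k, Proj.basicOpen (grading k) f) →+* Frac k :=
  genericValue _ (genericPt_mem_basicOpen hf)

/-- The Leibniz rule for sections over different basic open sets. -/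
theorem der_mul_of_basicValue (s : TangentSection (planeToSpec k))
    {f g h : MvPolynomial (Fin 3) k} (hf0 : f ≠ 0) (hg0 : g ≠ 0) (hh0 : h ≠ 0)
    (hf : f ∈ grading k 1) (hg : g ∈ grading k 1) (hh : h ∈ grading k 1)
    (a : Γ(Plane k, Proj.basicOpen (grading k) f)) (b : Γ(Plane k, Proj.basicOpen (grading k) g))
    (c : Γ(Plane k, Proj.basicOpen (grading k) h))
    (habc : basicValue hf0 a * basicValue hg0 b = basicValue hh0 c) :
    basicValue hf0 a * basicValue hg0 (s.der _ b) + basicValue hg0 b * basicValue hf0 (s.der _ a) =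
      basicValue hh0 (s.der _ c) := by
  -- All three sections restrict to `D₊(f g h)`. There the equality of generic values is an equality
  -- of sections, to which the derivation applies.
  have h0 : f * g * h ≠ 0 := mul_ne_zero (mul_ne_zero hf0 hg0) hh0
  have hd : f * g * h ∈ grading k (1 + 1 + 1) :=
    SetLike.mul_mem_graded (SetLike.mul_mem_graded hf hg) hh
  have lf : Proj.basicOpen (grading k) (f * g * h) ≤ Proj.basicOpen (grading k) f :=
    Proj.basicOpen_mono _ _ _ ⟨g * h, by ring⟩
  have lg : Proj.basicOpen (grading k) (f * g * h) ≤ Proj.basicOpen (grading k) g :=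
    Proj.basicOpen_mono _ _ _ ⟨f * h, by ring⟩
  have lh : Proj.basicOpen (grading k) (f * g * h) ≤ Proj.basicOpen (grading k) h :=
    Proj.basicOpen_mono _ _ _ ⟨f * g, by ring⟩
  have hη := genericPt_mem_basicOpen h0
  have hmul : ((Plane k).presheaf.map (homOfLE lf).op).hom a *
      ((Plane k).presheaf.map (homOfLE lg).op).hom b =
      ((Plane k).presheaf.map (homOfLE lh).op).hom c :=
    genericValue_injective h0 hd (by norm_num) (by
      rw [map_mul]
      exact habc)
  have hder := congrArg (s.der _) hmul
  rw [Derivation.leibniz, s.der_restrict _ _ lf, s.der_restrict _ _ lg, s.der_restrict _ _ lh,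
    smul_eq_mul, smul_eq_mul] at hder
  have := congrArg (genericValue _ hη) hder
  rw [map_add, map_mul, map_mul] at this
  exact this

/-- The quotient `m / l` of two linear forms, as a section over `D₊(l)`. -/
def ratio (l m : Fin 3 → k) : Γ(Plane k, Proj.basicOpen (grading k) (lin l)) :=
  frac (lin_mem l) 1 (lin m) (lin_mem' m)

theorem basicValue_ratio_mul {l : Fin 3 → k} (hl : lin l ≠ 0) (m : Fin 3 → k) :
    basicValue hl (ratio l m) * algebraMap (MvPolynomial (Fin 3) k) (Frac k) (lin l) = algebraMap _ _ (lin m) := by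
  have := genericValue_frac_mul hl (lin_mem l) 1 (lin m) (lin_mem' m)
  rwa [pow_one] at this

theorem algebraMap_ne_zero {f : MvPolynomial (Fin 3) k} (hf : f ≠ 0) :
    algebraMap (MvPolynomial (Fin 3) k) (Frac k) f ≠ 0 := by
  rw [Ne, map_eq_zero_iff _ (IsFractionRing.injective _ _)]
  exact hf

theorem basicValue_ratio {l : Fin 3 → k} (hl : lin l ≠ 0) (m : Fin 3 → k) :
    basicValue hl (ratio l m) = algebraMap _ _ (lin m) / algebraMap (MvPolynomial (Fin 3) k) (Frac k) (lin l) :=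
  (eq_div_iff (algebraMap_ne_zero hl)).mpr (basicValue_ratio_mul hl m)

theorem basicValue_injective {f : MvPolynomial (Fin 3) k} (hf0 : f ≠ 0) (hf : f ∈ grading k 1) :
    Function.Injective (basicValue hf0) := genericValue_injective hf0 hf one_pos

theorem ratio_self {l : Fin 3 → k} (hl : lin l ≠ 0) : ratio l l = 1 := by
  apply basicValue_injective hl (lin_mem l)
  rw [basicValue_ratio, map_one, div_self (algebraMap_ne_zero hl)]

theorem lin_single_ne_zero (i : Fin 3) : lin (Pi.single i (1 : k)) ≠ 0 := by
  rw [lin_single]; exact X_ne_zero i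

/-- The derivative of `X_j / X_i` is a quadratic form divided by `X_i ^ 2`. -/
theorem exists_quadratic_form (s : TangentSection (planeToSpec k)) {i j : Fin 3} (hij : i ≠ j) :
    ∃ p ∈ grading k 2, basicValue (lin_single_ne_zero i)
      (s.der _ (ratio (Pi.single i 1) (Pi.single j 1))) * algebraMap (MvPolynomial (Fin 3) k) (Frac k) (X i) ^ 2 =
        algebraMap _ _ p := by
  obtain ⟨n, p, hp, h1⟩ := exists_eq_frac (lin_mem (Pi.single i 1)) one_pos
    (s.der _ (ratio (Pi.single i 1) (Pi.single j 1)))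
  obtain ⟨m, q, hq, h2⟩ := exists_eq_frac (lin_mem (Pi.single j 1)) one_pos
    (s.der _ (ratio (Pi.single j 1) (Pi.single i 1)))
  have e1 := genericValue_frac_mul (lin_single_ne_zero i) (lin_mem (Pi.single i 1)) n p hp
  have e2 := genericValue_frac_mul (lin_single_ne_zero j) (lin_mem (Pi.single j 1)) m q hq
  rw [← h1] at e1
  rw [← h2] at e2
  -- Differentiating `(X_j/X_i)(X_i/X_j) = 1` relates a fraction with poles only along `X_i = 0` to
  -- one with poles only along `X_j = 0`.
  have h3 := der_mul_of_basicValue s (lin_single_ne_zero i) (lin_single_ne_zero j)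
    (lin_single_ne_zero i) (lin_mem _) (lin_mem _) (lin_mem _)
    (ratio (Pi.single i 1) (Pi.single j 1)) (ratio (Pi.single j 1) (Pi.single i 1)) 1 (by
      rw [basicValue_ratio, basicValue_ratio, map_one,
        div_mul_div_cancel₀ (algebraMap_ne_zero (lin_single_ne_zero i)),
        div_self (algebraMap_ne_zero (lin_single_ne_zero j))])
  rw [Derivation.map_one_eq_zero, map_zero, basicValue_ratio, basicValue_ratio] at h3
  replace e1 : basicValue (lin_single_ne_zero i) _ * _ = _ := e1
  replace e2 : basicValue (lin_single_ne_zero j) _ * _ = _ := e2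
  set u := basicValue (lin_single_ne_zero i) (s.der _ (ratio (Pi.single i 1) (Pi.single j 1)))
  set v := basicValue (lin_single_ne_zero j) (s.der _ (ratio (Pi.single j 1) (Pi.single i 1)))
  simp only [lin_single] at h3 e1 e2
  have xi := algebraMap_ne_zero (X_ne_zero (R := k) i)
  have xj := algebraMap_ne_zero (X_ne_zero (R := k) j)
  field_simp at h3
  have h4 : X j ^ m * (X i ^ 2 * p) = X i ^ n * (- X j ^ 2 * q) := by
    apply IsFractionRing.injective (MvPolynomial (Fin 3) k) (Frac k)
    simp only [map_mul, map_pow, map_neg, ← e1, ← e2]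
    linear_combination algebraMap (MvPolynomial (Fin 3) k) (Frac k) (X i) ^ n * algebraMap (MvPolynomial (Fin 3) k) (Frac k) (X j) ^ m * h3
  -- `X_i` is prime and does not divide `X_j ^ m`, so `X_i ^ n` divides `X_i² p`; the quotient is
  -- the desired quadratic form.
  obtain ⟨r, hr⟩ := (MvPolynomial.X_prime (R := k) (i := i)).pow_dvd_of_dvd_mul_left n
    (X_not_dvd_X_pow hij m) ⟨_, h4⟩
  refine ⟨r, ?_, ?_⟩
  · apply mem_grading_of_mul_mem (pow_ne_zero n (X_ne_zero (R := k) i))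
      (SetLike.pow_mem_graded n (X_mem_grading i))
    rw [← hr, add_comm]
    exact SetLike.mul_mem_graded (SetLike.pow_mem_graded 2 (X_mem_grading i)) hp
  · have h5 := congrArg (algebraMap (MvPolynomial (Fin 3) k) (Frac k)) hr
    simp only [map_mul, map_pow, ← e1] at h5
    apply mul_left_cancel₀ (pow_ne_zero n xi)
    linear_combination h5

theorem der_smul (s : TangentSection (planeToSpec k)) {U : (Plane k).Opens} (c : k)
    (a : Γ(Plane k, U)) : s.der U (constants (planeToSpec k) U c * a) =
      constants (planeToSpec k) U c * s.der U a := by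
  rw [Derivation.leibniz, s.der_constants, smul_zero, add_zero, smul_eq_mul]

theorem basicValue_constants {f : MvPolynomial (Fin 3) k} (hf : f ≠ 0) (c : k) :
    basicValue hf (constants (planeToSpec k) _ c) = algebraMap (MvPolynomial (Fin 3) k) (Frac k) (C c : MvPolynomial (Fin 3) k) :=
  genericValue_constants _ _ c

theorem ratio_eq_sum {l : Fin 3 → k} (hl : lin l ≠ 0) (m : Fin 3 → k) :
    ratio l m = ∑ i, constants (planeToSpec k) _ (m i) * ratio l (Pi.single i 1) := by
  apply basicValue_injective hl (lin_mem l)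
  rw [map_sum, basicValue_ratio, lin_apply m, map_sum, Finset.sum_div]
  refine Finset.sum_congr rfl fun i _ => ?_
  rw [map_mul, map_mul, basicValue_constants, basicValue_ratio, lin_single, mul_div_assoc]

/-- Every global vector field on the plane is given by an endomorphism of the space of linear
forms. -/
theorem exists_endomorphism (s : TangentSection (planeToSpec k)) :
    ∃ T : (Fin 3 → k) →ₗ[k] (Fin 3 → k), ∀ (l m : Fin 3 → k) (hl : lin l ≠ 0),
      basicValue hl (s.der _ (ratio l m)) * algebraMap (MvPolynomial (Fin 3) k) (Frac k) (lin l) ^ 2 =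
        algebraMap (MvPolynomial (Fin 3) k) (Frac k) (lin l * lin (T m) - lin m * lin (T l)) := by
  obtain ⟨p, hp, ep⟩ := exists_quadratic_form s (i := 0) (j := 1) (by decide)
  obtain ⟨r, hr, er⟩ := exists_quadratic_form s (i := 0) (j := 2) (by decide)
  obtain ⟨q, hq, eq⟩ := exists_quadratic_form s (i := 1) (j := 2) (by decide)
  have x0 := algebraMap_ne_zero (X_ne_zero (R := k) (0 : Fin 3))
  have x1 := algebraMap_ne_zero (X_ne_zero (R := k) (1 : Fin 3))
  -- The Leibniz rule for `X₂/X₀ = (X₂/X₁)(X₁/X₀)` is the cocycle condition.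
  have h1 := der_mul_of_basicValue s (lin_single_ne_zero 1) (lin_single_ne_zero 0)
    (lin_single_ne_zero 0) (lin_mem _) (lin_mem _) (lin_mem _)
    (ratio (Pi.single 1 1) (Pi.single 2 1)) (ratio (Pi.single 0 1) (Pi.single 1 1))
    (ratio (Pi.single 0 1) (Pi.single 2 1)) (by
      rw [basicValue_ratio, basicValue_ratio, basicValue_ratio,
        div_mul_div_cancel₀ (algebraMap_ne_zero (lin_single_ne_zero 1))])
  have cocycle : X 2 * p + X 0 * q = X 1 * r := by
    rw [basicValue_ratio, basicValue_ratio] at h1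
    simp only [lin_single] at h1
    field_simp at h1
    apply IsFractionRing.injective (MvPolynomial (Fin 3) k) (Frac k)
    simp only [map_mul, map_add, ← ep, ← er, ← eq]
    linear_combination algebraMap (MvPolynomial (Fin 3) k) (Frac k) (X 0) * h1
  obtain ⟨d, hd, hpd, hrd, hqd⟩ := koszul_exact hp hr cocycle
  choose t ht using fun i => exists_lin_eq (hd i)
  let T : (Fin 3 → k) →ₗ[k] (Fin 3 → k) := Fintype.linearCombination k t
  have hT : ∀ m, lin (T m) = ∑ i, C (m i) * d i := by
    intro m
    simp only [T, Fintype.linearCombination_apply, map_sum, map_smul, ht, smul_eq_C_mul]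
  have hT1 : ∀ i, lin (T (Pi.single i 1)) = d i := fun i => by simp [T, ht]
  have chart0 : ∀ m : Fin 3 → k, basicValue (lin_single_ne_zero 0)
      (s.der _ (ratio (Pi.single 0 1) m)) * algebraMap (MvPolynomial (Fin 3) k) (Frac k) (X 0) ^ 2 =
        algebraMap (MvPolynomial (Fin 3) k) (Frac k) (X 0 * lin (T m) - lin m * d 0) := by
    have base : ∀ i, basicValue (lin_single_ne_zero 0)
        (s.der _ (ratio (Pi.single 0 1) (Pi.single i 1))) * algebraMap (MvPolynomial (Fin 3) k) (Frac k) (X 0) ^ 2 =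
          algebraMap (MvPolynomial (Fin 3) k) (Frac k) (X 0 * d i - X i * d 0) := by
      intro i
      fin_cases i
      · simp [ratio_self (lin_single_ne_zero (k := k) 0)]
      · exact ep.trans (by rw [hpd]; rfl)
      · exact er.trans (by rw [hrd]; rfl)
    intro m
    rw [ratio_eq_sum (lin_single_ne_zero 0) m, map_sum, map_sum, Finset.sum_mul, hT, lin_apply m,
      Finset.mul_sum, Finset.sum_mul, ← Finset.sum_sub_distrib, map_sum]
    refine Finset.sum_congr rfl fun i _ => ?_
    rw [der_smul, map_mul, basicValue_constants, mul_assoc, base i, ← map_mul]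
    congr 1
    ring
  refine ⟨T, fun l m hl => ?_⟩
  have xl := algebraMap_ne_zero hl
  -- The formula passes from denominator `X₀` to denominator `l` through `m/X₀ = (m/l)(l/X₀)`.
  have h2 := der_mul_of_basicValue s hl (lin_single_ne_zero 0)
    (lin_single_ne_zero 0) (lin_mem _) (lin_mem _) (lin_mem _)
    (ratio l m) (ratio (Pi.single 0 1) l) (ratio (Pi.single 0 1) m) (by
      rw [basicValue_ratio, basicValue_ratio, basicValue_ratio, div_mul_div_cancel₀ xl])
  have cl := chart0 l
  have cm := chart0 m
  rw [basicValue_ratio, basicValue_ratio] at h2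
  generalize basicValue hl (s.der _ (ratio l m)) = D at h2 ⊢
  generalize basicValue (lin_single_ne_zero 0) (s.der _ (ratio (Pi.single 0 1) m)) = Dm at h2 cm
  generalize basicValue (lin_single_ne_zero 0) (s.der _ (ratio (Pi.single 0 1) l)) = Dl at h2 cl
  rw [lin_single] at h2
  simp only [map_sub, map_mul] at cl cm ⊢
  field_simp at h2
  apply mul_left_cancel₀ x0
  linear_combination algebraMap (MvPolynomial (Fin 3) k) (Frac k) (X 0) * h2 - algebraMap (MvPolynomial (Fin 3) k) (Frac k) (lin m) * cl
    + algebraMap (MvPolynomial (Fin 3) k) (Frac k) (lin l) * cm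

end VectorFields

/-! ### Affine charts attached to a basis of linear forms -/

section Charts

open MvPolynomial

variable {k : Type u} [Field k]

/-- At a point where `l` is invertible, the germ of `m/l` is a unit exactly when `m` is outside the
homogeneous prime. -/
theorem mem_basicOpen_ratio {l m : Fin 3 → k} {x : Plane k}
    (hx : x ∈ Proj.basicOpen (grading k) (lin l)) :
    x ∈ (Plane k).basicOpen (ratio l m) ↔ x ∈ Proj.basicOpen (grading k) (lin m) := by
  rw [Scheme.mem_basicOpen (Plane k) (ratio l m) x hx]
  have h1 : IsUnit ((Plane k).presheaf.germ _ x hx (ratio l m)) ↔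
      IsUnit ((ProjectiveSpectrum.Proj.awayToSection (grading k) (lin l)).hom'
        (HomogeneousLocalization.Away.mk (grading k) (lin_mem l) 1 (lin m) (lin_mem' m)) |>.1
          ⟨x, hx⟩) := by
    refine (MulEquiv.isUnit_map (Proj.stalkIso' (grading k) x)).symm.trans ?_
    exact iff_of_eq (congrArg IsUnit (Proj.stalkIso'_germ (grading k) _ x hx (ratio l m)))
  rw [h1, ← HomogeneousLocalization.isUnit_iff_isUnit_val,
    ProjectiveSpectrum.Proj.awayToSection_apply, HomogeneousLocalization.Away.val_mk,
    Localization.mk_eq_mk', IsLocalization.map_mk', IsLocalization.AtPrime.isUnit_mk'_iff]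
  rfl

theorem iSup_basicOpen_X : ⨆ i : Fin 3, Proj.basicOpen (grading k) (X i) = ⊤ := by
  apply Proj.iSup_basicOpen_eq_top' _ _ (fun i => ⟨1, X_mem_grading i⟩)
  rw [eq_top_iff]
  intro p _
  have hp : p ∈ Algebra.adjoin k (Set.range (X : Fin 3 → MvPolynomial (Fin 3) k)) := by
    rw [MvPolynomial.adjoin_range_X]; trivial
  induction hp using Algebra.adjoin_induction with
  | mem x hx => exact Algebra.subset_adjoin hx
  | algebraMap r =>
    exact Subalgebra.algebraMap_mem (Algebra.adjoin (grading k 0) _)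
      (⟨C r, isHomogeneous_C _ _⟩ : grading k 0)
  | add x y _ _ hx hy => exact add_mem (hx trivial) (hy trivial)
  | mul x y _ _ hx hy => exact mul_mem (hx trivial) (hy trivial)

variable (b : Module.Basis (Fin 3) k (Fin 3 → k))

theorem lin_basis_ne_zero (i : Fin 3) : lin (b i) ≠ 0 := lin_ne_zero (b.ne_zero i)

theorem exists_mem_basicOpen_basis (x : Plane k) :
    ∃ i, x ∈ Proj.basicOpen (grading k) (lin (b i)) := by
  by_contra! h
  have hx : x ∈ (⊤ : (Plane k).Opens) := trivial
  rw [← iSup_basicOpen_X, Opens.mem_iSup] at hx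
  obtain ⟨i, hi⟩ := hx
  apply hi
  rw [← lin_single, ← b.sum_repr (Pi.single i 1), map_sum]
  refine sum_mem fun j _ => ?_
  rw [map_smul, smul_eq_C_mul]
  have := h j
  rw [Proj.mem_basicOpen, not_not] at this
  exact Ideal.mul_mem_left _ _ this

/-- The affine chart of the plane where the `i`-th linear form of a basis does not vanish. -/
abbrev chart (i : Fin 3) : (Plane k).affineOpens :=
  ⟨Proj.basicOpen (grading k) (lin (b i)), Proj.isAffineOpen_basicOpen _ _ (lin_mem _) one_pos⟩

theorem iSup_chart : ⨆ i, (chart b i).1 = ⊤ := by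
  rw [eq_top_iff]
  intro x _
  rw [Opens.mem_iSup]
  exact exists_mem_basicOpen_basis b x

/-- The homogeneous coordinates in terms of the affine coordinates on the `i`-th chart. -/
def affineCoord (i : Fin 3) : Fin 3 → MvPolynomial (Fin 2) k :=
  i.insertNth (α := fun _ => MvPolynomial (Fin 2) k) 1 X

@[simp]
theorem affineCoord_same (i : Fin 3) : affineCoord (k := k) i i = 1 := by simp [affineCoord]

@[simp]
theorem affineCoord_succAbove (i : Fin 3) (j : Fin 2) :
    affineCoord (k := k) i (i.succAbove j) = X j := by simp [affineCoord]

/-- The coordinate map `k[u, v] ⟶ Γ(P², D₊(b i))`. -/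
def chartMap (i : Fin 3) : MvPolynomial (Fin 2) k →+* 
    Γ(Plane k, Proj.basicOpen (grading k) (lin (b i))) :=
  eval₂Hom (constants (planeToSpec k) _) fun j => ratio (b i) (b (i.succAbove j))

theorem chartMap_C (i : Fin 3) (c : k) :
    chartMap b i (C c) = constants (planeToSpec k) _ c := eval₂Hom_C _ _ _

theorem chartMap_affineCoord (i n : Fin 3) :
    chartMap b i (affineCoord i n) = ratio (b i) (b n) := by
  rcases Fin.eq_self_or_eq_succAbove i n with rfl | ⟨j, rfl⟩
  · rw [affineCoord_same, map_one, ratio_self (lin_basis_ne_zero b _)]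
  · rw [affineCoord_succAbove]
    exact eval₂Hom_X' _ _ _

/-- Dehomogenization with respect to the `i`-th form of a basis. -/
def dehomogenize (i : Fin 3) : MvPolynomial (Fin 3) k →ₐ[k] MvPolynomial (Fin 2) k :=
  aeval fun m => ∑ n, C (b.repr (Pi.single m 1) n) * affineCoord i n

theorem dehomogenize_lin (i : Fin 3) (c : Fin 3 → k) :
    dehomogenize b i (lin c) = ∑ n, C (b.repr c n) * affineCoord i n := by
  have h : (dehomogenize b i).toLinearMap ∘ₗ lin =
      ∑ n, LinearMap.toSpanSingleton k _ (affineCoord i n) ∘ₗ b.coord n := by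
    refine LinearMap.pi_ext' fun m => LinearMap.ext_ring ?_
    simp [dehomogenize, lin_single, smul_eq_C_mul]
  have := congr($h c)
  simpa [smul_eq_C_mul] using this

theorem dehomogenize_lin_basis (i n : Fin 3) :
    dehomogenize b i (lin (b n)) = affineCoord i n := by
  rw [dehomogenize_lin]
  simp [Finsupp.single_apply, apply_ite C, ite_mul]

/-- Checked on monomials: each of the `n` variables in a monomial of degree `n` contributes one
factor `t`. -/
theorem map_mul_pow_of_isHomogeneous {S : Type*} [CommRing S]
    (f g : MvPolynomial (Fin 3) k →+* S) (t : S) (hC : ∀ c, f (C c) = g (C c))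
    (hX : ∀ m, f (X m) * t = g (X m)) {n : ℕ} {p : MvPolynomial (Fin 3) k}
    (hp : p ∈ grading k n) : f p * t ^ n = g p := by
  rw [p.as_sum]
  simp only [map_sum, Finset.sum_mul]
  refine Finset.sum_congr rfl fun d hd => ?_
  have hdeg : d.degree = n := by
    by_contra h
    exact (mem_support_iff.mp hd) (IsHomogeneous.coeff_eq_zero hp h)
  rw [monomial_eq, Finsupp.prod_fintype _ _ (by simp), ← hdeg, Finsupp.degree_eq_sum,
    ← Finset.prod_pow_eq_pow_sum]
  simp only [map_mul, map_prod, map_pow, ← hX, mul_pow, Finset.prod_mul_distrib, hC]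
  ring

theorem basicValue_chartMap_dehomogenize (i : Fin 3) {n : ℕ} {p : MvPolynomial (Fin 3) k}
    (hp : p ∈ grading k n) :
    basicValue (lin_basis_ne_zero b i) (chartMap b i (dehomogenize b i p)) *
      algebraMap (MvPolynomial (Fin 3) k) (Frac k) (lin (b i)) ^ n = algebraMap _ _ p := by
  have hX : ∀ m, basicValue (lin_basis_ne_zero b i) (chartMap b i (dehomogenize b i (X m))) *
      algebraMap (MvPolynomial (Fin 3) k) (Frac k) (lin (b i)) =
      algebraMap (MvPolynomial (Fin 3) k) (Frac k) (X m) := by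
    intro m
    rw [← lin_single, dehomogenize_lin, map_sum, map_sum, Finset.sum_mul]
    nth_rw 2 [← b.sum_repr (Pi.single m 1)]
    rw [map_sum, map_sum]
    refine Finset.sum_congr rfl fun n _ => ?_
    rw [map_mul, map_mul, chartMap_affineCoord, mul_assoc, basicValue_ratio_mul, chartMap_C,
      basicValue_constants, ← map_mul, map_smul, smul_eq_C_mul]
  refine map_mul_pow_of_isHomogeneous
    (((basicValue (lin_basis_ne_zero b i)).comp (chartMap b i)).comp (dehomogenize b i).toRingHom)
    (algebraMap (MvPolynomial (Fin 3) k) (Frac k)) _ (fun c => ?_) hX hp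
  have : dehomogenize b i (C c) = C c := (dehomogenize b i).commutes c
  change basicValue (lin_basis_ne_zero b i) (chartMap b i (dehomogenize b i (C c))) = _
  rw [this, chartMap_C, basicValue_constants]

theorem chartMap_surjective (i : Fin 3) : Function.Surjective (chartMap b i) := by
  intro a
  obtain ⟨n, p, hp, rfl⟩ := exists_eq_frac (lin_mem (b i)) one_pos a
  refine ⟨dehomogenize b i p, basicValue_injective (lin_basis_ne_zero b i) (lin_mem _) ?_⟩
  apply mul_right_cancel₀ (pow_ne_zero n (algebraMap_ne_zero (lin_basis_ne_zero b i)))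
  rw [smul_eq_mul, mul_one] at hp
  rw [basicValue_chartMap_dehomogenize b i hp]
  exact (genericValue_frac_mul (lin_basis_ne_zero b i) (lin_mem _) n p _).symm

/-- Dehomogenization sends the form `b i` to `1`, so it extends to the localization and gives a left
inverse. -/
theorem chartMap_injective (i : Fin 3) : Function.Injective (chartMap b i) := by
  have hu : IsUnit (dehomogenize b i (lin (b i))) := by
    rw [dehomogenize_lin_basis, affineCoord_same]; exact isUnit_one
  let ret : HomogeneousLocalization.Away (grading k) (lin (b i)) →+* MvPolynomial (Fin 2) k :=
    (IsLocalization.Away.lift (S := Localization.Away (lin (b i))) (lin (b i))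
      (g := (dehomogenize b i).toRingHom) hu).comp (algebraMap _ _)
  have hret : ∀ n p hp, ret (HomogeneousLocalization.Away.mk (grading k) (lin_mem (b i)) n p hp) =
      dehomogenize b i p := by
    intro n p hp
    have h := Localization.mk_eq_mk' (R := MvPolynomial (Fin 3) k)
      (M := Submonoid.powers (lin (b i))) ▸ IsLocalization.mk'_spec
      (Localization.Away (lin (b i))) p (⟨lin (b i) ^ n, n, rfl⟩ : Submonoid.powers (lin (b i)))
    rw [← HomogeneousLocalization.Away.val_mk (𝒜 := grading k) n (lin_mem (b i)) p hp] at h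
    have h2 := congrArg (IsLocalization.Away.lift (S := Localization.Away (lin (b i)))
      (lin (b i)) (g := (dehomogenize b i).toRingHom) hu) h
    rw [map_mul, IsLocalization.Away.lift_eq, IsLocalization.Away.lift_eq] at h2
    have h3 : (dehomogenize b i).toRingHom (lin (b i) ^ n) = 1 := by
      change dehomogenize b i (lin (b i) ^ n) = 1
      rw [map_pow, dehomogenize_lin_basis, affineCoord_same, one_pow]
    rw [h3, mul_one] at h2
    exact h2
  let e := Proj.basicOpenIsoAway (grading k) (lin (b i)) (lin_mem _) one_pos
  have he : ∀ a, e.inv.hom ((Proj.awayToSection (grading k) (lin (b i))).hom a) = a := fun a =>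
    congr($(e.hom_inv_id).hom a)
  apply Function.LeftInverse.injective (g := fun a => ret (e.inv.hom a))
  intro q
  suffices ((ret.comp e.inv.hom).comp (chartMap b i)) = RingHom.id _ from congr($this q)
  apply MvPolynomial.ringHom_ext
  · intro c
    change ret (e.inv.hom (chartMap b i (C c))) = C c
    have hc : C c ∈ grading k (0 • 1) := by
      rw [zero_smul]; exact MvPolynomial.isHomogeneous_C _ _
    have : chartMap b i (C c) = frac (lin_mem (b i)) 0 (C c) hc := by
      apply basicValue_injective (lin_basis_ne_zero b i) (lin_mem _)
      have := genericValue_frac_mul (lin_basis_ne_zero b i) (lin_mem _) 0 (C c) hc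
      rw [pow_zero, mul_one] at this
      rw [chartMap_C, basicValue_constants]
      exact this.symm
    rw [this, frac, he, hret]
    exact (dehomogenize b i).commutes c
  · intro j
    change ret (e.inv.hom (chartMap b i (X j))) = X j
    rw [← affineCoord_succAbove i, chartMap_affineCoord, ratio, frac, he, hret,
      dehomogenize_lin_basis]

/-- The coordinate ring of the `i`-th chart is a polynomial ring in two variables. -/
def chartIso (i : Fin 3) : MvPolynomial (Fin 2) k ≃+* 
    Γ(Plane k, Proj.basicOpen (grading k) (lin (b i))) :=
  RingEquiv.ofBijective (chartMap b i) ⟨chartMap_injective b i, chartMap_surjective b i⟩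

/-- The components, on the `i`-th chart, of the vector field given by a matrix. -/
def component (M : Matrix (Fin 3) (Fin 3) k) (i : Fin 3) (j : Fin 2) : MvPolynomial (Fin 2) k :=
  ∑ n, C (M n (i.succAbove j)) * affineCoord i n - X j * ∑ n, C (M n i) * affineCoord i n

/-- `s` is the vector field of the endomorphism `T` of the space of linear forms. -/
def IsVectorFieldOf (s : TangentSection (planeToSpec k)) (T : (Fin 3 → k) →ₗ[k] (Fin 3 → k)) :
    Prop :=
  ∀ (l m : Fin 3 → k) (hl : lin l ≠ 0),
    basicValue hl (s.der _ (ratio l m)) * algebraMap (MvPolynomial (Fin 3) k) (Frac k) (lin l) ^ 2 =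
      algebraMap (MvPolynomial (Fin 3) k) (Frac k) (lin l * lin (T m) - lin m * lin (T l))

variable {b} {s : TangentSection (planeToSpec k)} {T : (Fin 3 → k) →ₗ[k] (Fin 3 → k)}
  {M : Matrix (Fin 3) (Fin 3) k}

/-- This is `s(m/l) = T(m)/l - (m/l)(T(l)/l)` for `l = b i` and `m` another basis form, written in
affine coordinates. -/
theorem der_chartMap_X (hs : IsVectorFieldOf s T) (hM : ∀ j, T (b j) = ∑ n, M n j • b n)
    (i : Fin 3) (j : Fin 2) :
    s.der _ (chartMap b i (X j)) = chartMap b i (component M i j) := by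
  apply basicValue_injective (lin_basis_ne_zero b i) (lin_mem _)
  have hb := algebraMap_ne_zero (lin_basis_ne_zero b i)
  have key : ∀ m, basicValue (lin_basis_ne_zero b i)
      (chartMap b i (∑ n, C (M n m) * affineCoord i n)) *
        algebraMap (MvPolynomial (Fin 3) k) (Frac k) (lin (b i)) =
      algebraMap (MvPolynomial (Fin 3) k) (Frac k) (lin (T (b m))) := by
    intro m
    rw [hM]
    simp only [map_sum, Finset.sum_mul]
    refine Finset.sum_congr rfl fun n _ => ?_
    rw [map_mul, map_mul, chartMap_affineCoord, mul_assoc, basicValue_ratio_mul, chartMap_C,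
      basicValue_constants, ← map_mul, map_smul, smul_eq_C_mul]
  rw [component, map_sub, map_sub, map_mul, map_mul, ← affineCoord_succAbove i,
    chartMap_affineCoord]
  have h1 := hs (b i) (b (i.succAbove j)) (lin_basis_ne_zero b i)
  have h2 := key (i.succAbove j)
  have h3 := key i
  have h4 := basicValue_ratio_mul (lin_basis_ne_zero b i) (b (i.succAbove j))
  apply mul_right_cancel₀ (pow_ne_zero 2 hb)
  refine h1.trans ?_
  rw [map_sub, map_mul, map_mul, ← h2, ← h3, ← h4]
  ring

/-- A derivation that kills constants takes values in the ideal generated by its values on the two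
coordinates, by the Leibniz rule. -/
theorem zeroIdeal_chart (hs : IsVectorFieldOf s T) (hM : ∀ j, T (b j) = ∑ n, M n j • b n)
    (i : Fin 3) :
    s.zeroIdeal.ideal (chart b i) =
      (Ideal.span (Set.range (component M i))).map (chartIso b i : _ →+* _) := by
  have hmem : ∀ j, s.der _ (chartMap b i (X j)) ∈
      (Ideal.span (Set.range (component M i))).map (chartMap b i) := fun j => by
    rw [der_chartMap_X hs hM]
    exact Ideal.mem_map_of_mem _ (Ideal.subset_span ⟨j, rfl⟩)
  change Ideal.span (Set.range (s.der (chart b i).1)) =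
    (Ideal.span (Set.range (component M i))).map (chartMap b i)
  apply le_antisymm
  · rw [Ideal.span_le]
    rintro _ ⟨a, rfl⟩
    obtain ⟨q, rfl⟩ := chartMap_surjective b i a
    induction q using MvPolynomial.induction_on with
    | C c => rw [chartMap_C, s.der_constants]; exact zero_mem _
    | add p q hp hq => rw [map_add, map_add]; exact add_mem hp hq
    | mul_X p j hp =>
      rw [map_mul, Derivation.leibniz]
      exact add_mem (Ideal.mul_mem_left _ _ (hmem j)) (Ideal.mul_mem_left _ _ hp)
  · rw [Ideal.map_span, Ideal.span_le]
    rintro _ ⟨_, ⟨j, rfl⟩, rfl⟩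
    rw [← der_chartMap_X hs hM]
    exact Ideal.subset_span ⟨_, rfl⟩

end Charts

/-! ### Lengths and associated primes of local rings -/

section Algebra

/-- The length of a ring over itself is the Krull dimension of its lattice of ideals, which only
depends on the ring up to isomorphism. -/
theorem length_eq_of_ringEquiv {R S : Type*} [CommRing R] [CommRing S] (e : R ≃+* S) :
    Module.length R R = Module.length S S := by
  apply WithBot.coe_injective
  rw [Module.coe_length, Module.coe_length]
  exact (Order.krullDim_eq_of_orderIso e.idealComapOrderIso).symm

/-- The order function is additive on products, and the irreducible element `X` has order one. -/
theorem length_truncated_polynomial (k : Type*) [Field k] (n : ℕ) :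
    Module.length (Polynomial k ⧸ Ideal.span {(Polynomial.X : Polynomial k) ^ n})
      (Polynomial k ⧸ Ideal.span {(Polynomial.X : Polynomial k) ^ n}) = n := by
  rw [← Module.length_eq_of_surjective (S := Polynomial k) Ideal.Quotient.mk_surjective]
  have h := Ring.ord_pow (R := Polynomial k) (x := Polynomial.X)
    (mem_nonZeroDivisors_of_ne_zero Polynomial.X_ne_zero) n
  rw [Ring.ord_of_irreducible Polynomial.irreducible_X, nsmul_one] at h
  exact h

theorem prime_truncated_polynomial {k : Type*} [Field k] {n : ℕ}
    (P : Ideal (Polynomial k ⧸ Ideal.span {(Polynomial.X : Polynomial k) ^ n})) [hP : P.IsPrime] :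
    P = (Ideal.span {Polynomial.X}).map (Ideal.Quotient.mk _) := by
  have hmax : (Ideal.span {(Polynomial.X : Polynomial k)}).IsMaximal :=
    PrincipalIdealRing.isMaximal_of_irreducible Polynomial.irreducible_X
  have hX : Polynomial.X ∈ P.comap (Ideal.Quotient.mk _) := by
    apply (P.comap_isPrime (Ideal.Quotient.mk _)).mem_of_pow_mem n
    rw [Ideal.mem_comap, Ideal.Quotient.eq_zero_iff_mem.mpr (Ideal.mem_span_singleton_self _)]
    exact zero_mem _
  have h := hmax.eq_of_le (P.comap_isPrime (Ideal.Quotient.mk _)).ne_top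
    ((Ideal.span_singleton_le_iff_mem _).mpr hX)
  rw [h, Ideal.map_comap_of_surjective _ Ideal.Quotient.mk_surjective]

theorem nontrivial_truncated_polynomial {k : Type*} [Field k] {n : ℕ} (hn : n ≠ 0) :
    Nontrivial (Polynomial k ⧸ Ideal.span {(Polynomial.X : Polynomial k) ^ n}) := by
  rw [Ideal.Quotient.nontrivial_iff, Ne, Ideal.span_singleton_eq_top]
  intro h
  exact Polynomial.not_isUnit_X ((isUnit_pow_iff hn).mp h)

/-- If every prime ideal equals `P`, localizing at `P` does nothing. -/
theorem length_localization_of_forall_prime_eq {A S : Type*} [CommRing A] [CommRing S] [Algebra A S]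
    (P : Ideal A) [P.IsPrime] [IsLocalization.AtPrime S P]
    (hP : ∀ Q : Ideal A, Q.IsPrime → Q = P) : Module.length S S = Module.length A A := by
  have hu : P.primeCompl ≤ IsUnit.submonoid A := by
    intro a ha
    by_contra hna
    obtain ⟨m, hm, ham⟩ := exists_max_ideal_of_mem_nonunits hna
    exact ha (hP m hm.isPrime ▸ ham)
  exact (length_eq_of_ringEquiv (IsLocalization.atUnits A P.primeCompl (S := S) hu).toRingEquiv).symm

/-- A criterion for the closed point of a localization at a prime to be embedded. -/
theorem maximalIdeal_mem_associatedPrimes_notMem_minimalPrimes {A S : Type*} [CommRing A]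
    [CommRing S] [IsLocalRing S] [Algebra A S] (P : Ideal A) [P.IsPrime]
    [IsLocalization.AtPrime S P] (u v : A) (hann : ∀ a ∈ P, a * v = 0)
    (hv : ∀ t ∉ P, t * v ≠ 0) (hu : u ∈ P) (hun : ∀ t ∉ P, ∀ n : ℕ, t * u ^ n ≠ 0) :
    IsLocalRing.maximalIdeal S ∈ associatedPrimes S S ∧
      IsLocalRing.maximalIdeal S ∉ minimalPrimes S := by
  have hmem : ∀ a, algebraMap A S a ∈ IsLocalRing.maximalIdeal S ↔ a ∈ P :=
    fun a => IsLocalization.AtPrime.to_map_mem_maximal_iff S P a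
  have hinj : ∀ a, (∀ t ∉ P, t * a ≠ 0) → algebraMap A S a ≠ 0 := by
    intro a ha h0
    obtain ⟨⟨t, ht⟩, h⟩ := (IsLocalization.map_eq_zero_iff P.primeCompl S a).mp h0
    exact ha t ht h
  -- The annihilator of `v` contains the maximal ideal because `P` kills `v`, and it is proper
  -- because `v` survives localization.
  have hcolon : Submodule.colon (⊥ : Submodule S S) {algebraMap A S v} =
      IsLocalRing.maximalIdeal S := by
    symm
    apply (IsLocalRing.maximalIdeal.isMaximal S).eq_of_le
    · intro h
      have h1 : (1 : S) ∈ Submodule.colon (⊥ : Submodule S S) {algebraMap A S v} := by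
        rw [h]; trivial
      rw [Submodule.mem_colon_singleton, one_smul, Submodule.mem_bot] at h1
      exact hinj v hv h1
    · intro s hs
      rw [Submodule.mem_colon_singleton, Submodule.mem_bot, smul_eq_mul]
      obtain ⟨⟨a, t⟩, h⟩ := IsLocalization.surj P.primeCompl s
      have ht := IsLocalization.map_units S t
      have ha : a ∈ P := by
        rw [← hmem, ← h]
        exact Ideal.mul_mem_right _ _ hs
      apply ht.mul_left_cancel
      rw [mul_zero, ← mul_assoc, mul_comm _ s, h, ← map_mul, hann a ha, map_zero]
  refine ⟨⟨inferInstance, algebraMap A S v, ?_⟩, fun hmin => ?_⟩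
  · rw [hcolon]
    exact ((IsLocalRing.maximalIdeal.isMaximal S).isPrime.isRadical.radical).symm
  -- Some prime omits the non-nilpotent element `u` of the maximal ideal, so the maximal ideal is
  -- not minimal.
  · have hnil : ¬ IsNilpotent (algebraMap A S u) := by
      rintro ⟨n, hn⟩
      rw [← map_pow] at hn
      exact hinj (u ^ n) (fun t ht => hun t ht n) hn
    rw [nilpotent_iff_mem_prime] at hnil
    push Not at hnil
    obtain ⟨Q, hQ, huQ⟩ := hnil
    apply huQ
    exact hmin.2 ⟨hQ, bot_le⟩ (IsLocalRing.le_maximalIdeal hQ.ne_top) ((hmem u).mpr hu)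

end Algebra

/-! ### Points and local rings of closed subschemes on an affine open set -/

section Subschemes

variable {X : Scheme.{u}} (I : X.IdealSheafData) (U : X.affineOpens)

theorem isIso_stalkMap_of_isOpenImmersion {Y Z : Scheme.{u}} (f : Y ⟶ Z) [IsOpenImmersion f]
    (y : Y) : IsIso (f.stalkMap y) := inferInstance

instance isOpenImmersion_subschemeCover : IsOpenImmersion (I.subschemeCover.f U) :=
  I.subschemeCover.map_prop U

theorem exists_subschemeCover_eq {x : I.subscheme} (hx : I.subschemeι x ∈ U.1) :
    ∃ y, I.subschemeCover.f U y = x := by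
  have : x ∈ (I.subschemeCover.f U).opensRange := by
    rw [I.opensRange_subschemeCover_map U]; exact hx
  exact this

theorem subschemeι_subschemeCover_mem (y) :
    I.subschemeι (I.subschemeCover.f U y) ∈ U.1 := by
  have : I.subschemeCover.f U y ∈ (I.subschemeCover.f U).opensRange := ⟨y, rfl⟩
  rwa [I.opensRange_subschemeCover_map U] at this

/-- The local rings of a closed subscheme are localizations of `Γ(X, U) ⧸ I(U)`. -/
def stalkEquiv (y : PrimeSpectrum (Γ(X, U.1) ⧸ I.ideal U)) :
    I.subscheme.presheaf.stalk (I.subschemeCover.f U y) ≃+* Localization.AtPrime y.asIdeal :=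
  have : IsIso ((I.subschemeCover.f U).stalkMap y) :=
    @isIso_stalkMap_of_isOpenImmersion _ _ (I.subschemeCover.f U)
      (isOpenImmersion_subschemeCover I U) y
  (asIso ((I.subschemeCover.f U).stalkMap y) ≪≫
    Spec.stalkIso (.of (Γ(X, U.1) ⧸ I.ideal U)) y).commRingCatIsoToRingEquiv

theorem subschemeι_subschemeCover (y : PrimeSpectrum (Γ(X, U.1) ⧸ I.ideal U)) :
    I.subschemeι (I.subschemeCover.f U y) =
      U.2.fromSpec (PrimeSpectrum.comap (Ideal.Quotient.mk (I.ideal U)) y) := by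
  have h := I.subschemeCover_map_subschemeι U
  rw [I.glueDataObjι_ι] at h
  exact congr($h y)

/-- A point of the closed subscheme cut out over `U` by an ideal with quotient `k[t] ⧸ (t ^ n)`. -/
theorem exists_fat_point {k : Type*} [Field k] {n : ℕ} (hn : n ≠ 0)
    (e : (Γ(X, U.1) ⧸ I.ideal U) ≃+*
      (Polynomial k ⧸ Ideal.span {(Polynomial.X : Polynomial k) ^ n})) :
    ∃ x : I.subscheme, I.subschemeι x ∈ U.1 ∧ (∀ y, I.subschemeι y ∈ U.1 → y = x) ∧
      multiplicity I.subscheme x = n := by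
  have := nontrivial_truncated_polynomial (k := k) hn
  have : Nontrivial (Γ(X, U.1) ⧸ I.ideal U) := e.toEquiv.nontrivial
  -- `k[t] ⧸ (t ^ n)` has a single prime, so there is only one point over `U`, and the quotient is
  -- already its local ring.
  have huniq : ∀ P Q : Ideal (Γ(X, U.1) ⧸ I.ideal U), P.IsPrime → Q.IsPrime → P = Q := by
    intro P Q hP hQ
    have h1 := prime_truncated_polynomial (P.comap e.symm)
    have h2 := prime_truncated_polynomial (Q.comap e.symm)
    have := congrArg (Ideal.comap e) (h1.trans h2.symm)
    ext a
    have ha := congr(a ∈ $this)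
    simpa using ha
  obtain ⟨y⟩ : Nonempty (PrimeSpectrum (Γ(X, U.1) ⧸ I.ideal U)) := inferInstance
  refine ⟨I.subschemeCover.f U y, subschemeι_subschemeCover_mem I U y, ?_, ?_⟩
  · intro z hz
    obtain ⟨w, rfl⟩ := exists_subschemeCover_eq I U hz
    exact congrArg _ (PrimeSpectrum.ext (huniq _ _ w.2 y.2))
  · rw [multiplicity, length_eq_of_ringEquiv (stalkEquiv I U y),
      length_localization_of_forall_prime_eq y.asIdeal (fun Q hQ => huniq _ _ hQ y.2),
      length_eq_of_ringEquiv e, length_truncated_polynomial]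

theorem isEmbeddedPoint_of_localization (y : PrimeSpectrum (Γ(X, U.1) ⧸ I.ideal U))
    (u v : Γ(X, U.1) ⧸ I.ideal U) (hann : ∀ a ∈ y.asIdeal, a * v = 0)
    (hv : ∀ t ∉ y.asIdeal, t * v ≠ 0) (hu : u ∈ y.asIdeal)
    (hun : ∀ t ∉ y.asIdeal, ∀ n : ℕ, t * u ^ n ≠ 0) :
    IsEmbeddedPoint I.subscheme (I.subschemeCover.f U y) := by
  let := ((stalkEquiv I U y).symm.toRingHom.comp (algebraMap (Γ(X, U.1) ⧸ I.ideal U)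
    (Localization.AtPrime y.asIdeal))).toAlgebra
  have : IsLocalization.AtPrime (I.subscheme.presheaf.stalk (I.subschemeCover.f U y)) y.asIdeal :=
    (IsLocalization.isLocalization_iff_of_ringEquiv y.asIdeal.primeCompl
      (stalkEquiv I U y).symm).mp inferInstance
  exact maximalIdeal_mem_associatedPrimes_notMem_minimalPrimes y.asIdeal u v hann hv hu hun

theorem subschemeι_notMem_of_ideal_eq_top (h : I.ideal U = ⊤) (x : I.subscheme) :
    I.subschemeι x ∉ U.1 := by
  intro hx
  obtain ⟨y, rfl⟩ := exists_subschemeCover_eq I U hx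
  have : Subsingleton (Γ(X, U.1) ⧸ I.ideal U) := Ideal.Quotient.subsingleton_iff.mpr h
  exact (PrimeSpectrum.isEmpty_iff_subsingleton.mpr this).false y

/-- The ideal of a reduced closed subscheme over an affine open set. -/
theorem vanishingIdeal_ideal_eq (Z : Closeds X) (J : Ideal Γ(X, U.1)) (hJ : J.IsRadical)
    (h : ∀ x ∈ U.1, x ∈ Z ↔ x ∈ X.zeroLocus (U := U.1) (J : Set Γ(X, U.1))) :
    (Scheme.IdealSheafData.vanishingIdeal Z).ideal U = J := by
  have h1 : U.2.fromSpec ⁻¹' (Z : Set X) = PrimeSpectrum.zeroLocus (J : Set Γ(X, U.1)) := by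
    rw [← U.2.fromSpec_preimage_zeroLocus]
    ext y
    refine h _ ?_
    have : U.2.fromSpec y ∈ Set.range U.2.fromSpec := ⟨y, rfl⟩
    rwa [U.2.range_fromSpec] at this
  refine (congrArg PrimeSpectrum.vanishingIdeal h1).trans ?_
  rw [PrimeSpectrum.vanishingIdeal_zeroLocus_eq_radical, hJ.radical]

end Subschemes

/-! ### Local comparison of ideal sheaves -/

section Local

variable {X : Scheme.{u}}

/-- The restriction of sections from `U` to a basic open subset. -/
abbrev resBasic {U : X.affineOpens} (f : Γ(X, U.1)) :
    Γ(X, U.1) →+* Γ(X, (X.affineBasicOpen f).1) :=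
  (X.presheaf.map (homOfLE (X.basicOpen_le f)).op).hom

theorem resBasic_mem_map_iff (U : X.affineOpens) (f a : Γ(X, U.1))
    (K : Ideal Γ(X, U.1)) : resBasic f a ∈ K.map (resBasic f) ↔ ∃ n : ℕ, f ^ n * a ∈ K := by
  let : Algebra Γ(X, U.1) Γ(X, (X.affineBasicOpen f).1) := (resBasic f).toAlgebra
  have : IsLocalization.Away f Γ(X, (X.affineBasicOpen f).1) := U.2.isLocalization_of_eq_basicOpen _ _ rfl
  refine (IsLocalization.algebraMap_mem_map_algebraMap_iff (Submonoid.powers f) _ K a).trans ?_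
  constructor
  · rintro ⟨_, ⟨n, rfl⟩, h⟩; exact ⟨n, h⟩
  · rintro ⟨n, h⟩; exact ⟨_, ⟨n, rfl⟩, h⟩

/-- Inclusion of ideals of sections over an affine open set is a local question. -/
theorem ideal_le_of_local (U : X.affineOpens) (K L : Ideal Γ(X, U.1))
    (h : ∀ x ∈ U.1, ∃ f : Γ(X, U.1), x ∈ X.basicOpen f ∧ K.map (resBasic f) ≤ L.map (resBasic f)) :
    K ≤ L := by
  have hU : IsAffineOpen U.1 := U.2
  intro a ha
  by_contra hna
  -- Near the point of a maximal ideal `m` containing `L : a`, the hypothesis gives `f ^ n * a ∈ L`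
  -- with `f ∉ m`, a contradiction.
  have hne : L.colon {a} ≠ ⊤ := by
    intro htop
    have : (1 : Γ(X, U.1)) ∈ L.colon {a} := by rw [htop]; trivial
    rw [Submodule.mem_colon_singleton, one_smul] at this
    exact hna this
  obtain ⟨m, hm, hLm⟩ := Ideal.exists_le_maximal _ hne
  let y : PrimeSpectrum Γ(X, U.1) := ⟨m, hm.isPrime⟩
  have hy : hU.fromSpec y ∈ U.1 := by
    have : hU.fromSpec y ∈ Set.range hU.fromSpec := ⟨y, rfl⟩
    rwa [hU.range_fromSpec] at this
  obtain ⟨f, hf, hfK⟩ := h _ hy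
  obtain ⟨n, hn⟩ := (resBasic_mem_map_iff U f a L).mp (hfK (Ideal.mem_map_of_mem _ ha))
  have hfm : f ∉ m := by
    rw [← hU.fromSpec_image_basicOpen] at hf
    obtain ⟨z, hz, hzy⟩ := hf
    have : z = y := hU.fromSpec.isOpenEmbedding.injective hzy
    subst this
    exact hz
  apply hfm
  apply hm.isPrime.mem_of_pow_mem n
  apply hLm
  rw [Submodule.mem_colon_singleton]
  exact hn

theorem map_resBasic_ideal (I : X.IdealSheafData) (U : X.affineOpens) (f : Γ(X, U.1)) :
    (I.ideal U).map (resBasic f) = I.ideal (X.affineBasicOpen f) := I.map_ideal_basicOpen U f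

/-- Around `x`, the sets `U` and `W` share an open set basic in both; equality on `W` restricts to
it, and such sets cover `U`. -/
theorem ideal_eq_of_local (I J : X.IdealSheafData) (U : X.affineOpens)
    (h : ∀ x ∈ U.1, ∃ W : X.affineOpens, x ∈ W.1 ∧ I.ideal W = J.ideal W) :
    I.ideal U = J.ideal U := by
  have key : ∀ x ∈ U.1, ∃ f : Γ(X, U.1), x ∈ X.basicOpen f ∧
      (I.ideal U).map (resBasic f) = (J.ideal U).map (resBasic f) := by
    intro x hx
    obtain ⟨W, hxW, hW⟩ := h x hx
    obtain ⟨f, g, hfg, hxf⟩ := exists_basicOpen_le_affine_inter U.2 W.2 x ⟨hx, hxW⟩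
    refine ⟨f, hxf, ?_⟩
    have hle : X.affineBasicOpen f ≤ W := (hfg.le.trans (X.basicOpen_le g) : X.basicOpen f ≤ W.1)
    rw [map_resBasic_ideal, map_resBasic_ideal, ← I.map_ideal hle, ← J.map_ideal hle, hW]
  apply le_antisymm
  · exact ideal_le_of_local U _ _ fun x hx => (key x hx).imp fun f hf => ⟨hf.1, hf.2.le⟩
  · exact ideal_le_of_local U _ _ fun x hx => (key x hx).imp fun f hf => ⟨hf.1, hf.2.ge⟩

/-- Suppose that the ideal sheaves `I ≤ J` agree away from a closed point `p`. If `J(U) ⧸ I(U)` is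
simple for one affine open neighbourhood `U` of `p`, then this holds for all of them. -/
theorem covBy_of_covBy {I J : X.IdealSheafData} (hIJ : I ≤ J) {p : X}
    (hp : IsClosed ({p} : Set X))
    (haway : ∀ W : X.affineOpens, p ∉ W.1 → I.ideal W = J.ideal W)
    {U₀ U : X.affineOpens} (hp₀ : p ∈ U₀.1) (hpU : p ∈ U.1) (h₀ : I.ideal U₀ ⋖ J.ideal U₀) :
    I.ideal U ⋖ J.ideal U := by
  obtain ⟨f, g, hfg, hpf⟩ := exists_basicOpen_le_affine_inter U.2 U₀.2 p ⟨hpU, hp₀⟩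
  have hsep : ∀ x, x ≠ p → ∀ V : X.affineOpens, x ∈ V.1 →
      ∃ h : Γ(X, V.1), x ∈ X.basicOpen h ∧ p ∉ X.basicOpen h := by
    intro x hxp V hxV
    obtain ⟨h, hle, hxh⟩ := V.2.exists_basicOpen_le (V := ⟨{p}ᶜ, hp.isOpen_compl⟩) ⟨x, hxp⟩ hxV
    exact ⟨h, hxh, fun hph => hle hph rfl⟩
  -- on the common basic open neighbourhood of `p`
  have hWne : I.ideal (X.affineBasicOpen g) ≠ J.ideal (X.affineBasicOpen g) := by
    intro heq
    apply h₀.lt.ne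
    apply ideal_eq_of_local
    intro x hx
    by_cases hxp : x = p
    · exact ⟨X.affineBasicOpen g, (by rw [hxp]; exact hfg.le hpf), heq⟩
    · obtain ⟨h, hxh, hph⟩ := hsep x hxp U₀ hx
      exact ⟨X.affineBasicOpen h, hxh, haway _ hph⟩
  have hW : I.ideal (X.affineBasicOpen g) ⋖ J.ideal (X.affineBasicOpen g) := by
    refine ⟨lt_of_le_of_ne (hIJ _) hWne, fun K hIK hKJ => ?_⟩
    let : Algebra Γ(X, U₀.1) Γ(X, (X.affineBasicOpen g).1) := (resBasic g).toAlgebra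
    have : IsLocalization.Away g Γ(X, (X.affineBasicOpen g).1) :=
      U₀.2.isLocalization_of_eq_basicOpen _ _ rfl
    -- An intermediate ideal on the basic open set is contracted to one between `I(U₀)` and `J(U₀)`;
    -- localizing it gives back `K`.
    let K' : Ideal Γ(X, U₀.1) := K.comap (resBasic g) ⊓ J.ideal U₀
    have hK' : K'.map (resBasic g) = K := by
      have h1 : K'.map (resBasic g) =
          (K.comap (resBasic g)).map (resBasic g) ⊓ (J.ideal U₀).map (resBasic g) :=
        IsLocalization.map_inf (Submonoid.powers g) Γ(X, (X.affineBasicOpen g).1) _ _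
      have h2 : (K.comap (resBasic g)).map (resBasic g) = K :=
        IsLocalization.map_under (Submonoid.powers g) Γ(X, (X.affineBasicOpen g).1) K
      rw [h1, h2, map_resBasic_ideal]
      exact inf_eq_left.mpr hKJ.le
    have hIK' : I.ideal U₀ ≤ K' := by
      refine le_inf ?_ (hIJ _)
      rw [← Ideal.map_le_iff_le_comap, map_resBasic_ideal]
      exact hIK.le
    rcases h₀.eq_or_eq hIK' inf_le_right with h | h
    · rw [h, map_resBasic_ideal] at hK'
      exact hIK.ne hK'
    · rw [h, map_resBasic_ideal] at hK'
      exact hKJ.ne hK'.symm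
  have hW' : (I.ideal U).map (resBasic f) ⋖ (J.ideal U).map (resBasic f) := by
    rw [map_resBasic_ideal, map_resBasic_ideal]
    have : X.affineBasicOpen f = X.affineBasicOpen g := Subtype.ext hfg
    rw [this]
    exact hW
  have hlt : I.ideal U < J.ideal U := by
    refine lt_of_le_of_ne (hIJ _) fun h => ?_
    rw [h] at hW'
    exact hW'.lt.ne rfl
  refine ⟨hlt, fun K hIK hKJ => ?_⟩
  -- Away from `p` the ideals `I` and `J` coincide, so ideals lying between them need only be
  -- compared near `p`.
  have hglue : ∀ A B : Ideal Γ(X, U.1), I.ideal U ≤ B → A ≤ J.ideal U →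
      A.map (resBasic f) ≤ B.map (resBasic f) → A ≤ B := by
    intro A B hB hA hAB
    refine ideal_le_of_local U A B fun x hx => ?_
    by_cases hxp : x = p
    · exact ⟨f, hxp ▸ hpf, hAB⟩
    · obtain ⟨h, hxh, hph⟩ := hsep x hxp U hx
      refine ⟨h, hxh, (Ideal.map_mono hA).trans (le_trans ?_ (Ideal.map_mono hB))⟩
      rw [map_resBasic_ideal, map_resBasic_ideal, haway _ hph]
  rcases hW'.eq_or_eq (Ideal.map_mono hIK.le) (Ideal.map_mono hKJ.le) with h | h
  · exact hIK.not_ge (hglue K _ le_rfl hKJ.le h.le)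
  · exact hKJ.not_ge (hglue _ K hIK.le le_rfl h.ge)

end Local

/-! ### Ideals in chart coordinates and chart origins -/

section ChartIdeals

open MvPolynomial

variable {k : Type u} [Field k]

theorem affineCoord_zero : affineCoord (k := k) 0 = ![1, X 0, X 1] := by
  funext n; fin_cases n <;> rfl

theorem affineCoord_one : affineCoord (k := k) 1 = ![X 0, 1, X 1] := by
  funext n; fin_cases n <;> rfl

theorem affineCoord_two : affineCoord (k := k) 2 = ![X 0, X 1, 1] := by
  funext n; fin_cases n <;> rfl

variable (M : Matrix (Fin 3) (Fin 3) k)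

theorem component_zero : component M 0 =
    ![C (M 0 1) + C (M 1 1) * X 0 + C (M 2 1) * X 1 -
        X 0 * (C (M 0 0) + C (M 1 0) * X 0 + C (M 2 0) * X 1),
      C (M 0 2) + C (M 1 2) * X 0 + C (M 2 2) * X 1 -
        X 1 * (C (M 0 0) + C (M 1 0) * X 0 + C (M 2 0) * X 1)] := by
  funext j
  fin_cases j <;> simp [component, Fin.sum_univ_three, affineCoord_zero]

theorem component_one : component M 1 =
    ![C (M 0 0) * X 0 + C (M 1 0) + C (M 2 0) * X 1 -
        X 0 * (C (M 0 1) * X 0 + C (M 1 1) + C (M 2 1) * X 1),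
      C (M 0 2) * X 0 + C (M 1 2) + C (M 2 2) * X 1 -
        X 1 * (C (M 0 1) * X 0 + C (M 1 1) + C (M 2 1) * X 1)] := by
  have h0 : (1 : Fin 3).succAbove (0 : Fin 2) = 0 := rfl
  have h1 : (1 : Fin 3).succAbove (1 : Fin 2) = 2 := rfl
  funext j
  fin_cases j <;> simp [component, Fin.sum_univ_three, affineCoord_one, h0, h1]

theorem component_two : component M 2 =
    ![C (M 0 0) * X 0 + C (M 1 0) * X 1 + C (M 2 0) -
        X 0 * (C (M 0 2) * X 0 + C (M 1 2) * X 1 + C (M 2 2)),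
      C (M 0 1) * X 0 + C (M 1 1) * X 1 + C (M 2 1) -
        X 1 * (C (M 0 2) * X 0 + C (M 1 2) * X 1 + C (M 2 2))] := by
  have h0 : (2 : Fin 3).succAbove (0 : Fin 2) = 0 := rfl
  have h1 : (2 : Fin 3).succAbove (1 : Fin 2) = 1 := rfl
  funext j
  fin_cases j <;> simp [component, Fin.sum_univ_three, affineCoord_two, h0, h1]

theorem range_vecCons_pair {α : Type*} (a b : α) : Set.range ![a, b] = {a, b} := by
  simp [Matrix.range_cons, Set.pair_comm]

theorem constantCoeff_eq_zero_iff (q : MvPolynomial (Fin 2) k) :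
    constantCoeff q = 0 ↔ q ∈ Ideal.span {X 0, X 1} := by
  constructor
  · have key : ∀ q : MvPolynomial (Fin 2) k, q - C (constantCoeff q) ∈
        Ideal.span ({X 0, X 1} : Set (MvPolynomial (Fin 2) k)) := by
      intro q
      induction q using MvPolynomial.induction_on with
      | C a => simp
      | add p q hp hq =>
        rw [map_add, C_add, add_sub_add_comm]
        exact add_mem hp hq
      | mul_X p j _ =>
        rw [map_mul, constantCoeff_X, mul_zero, C_0, sub_zero]
        refine Ideal.mul_mem_left _ _ (Ideal.subset_span ?_)
        fin_cases j <;> simp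
    intro h
    have := key q
    rwa [h, C_0, sub_zero] at this
  · intro h
    obtain ⟨a, b, rfl⟩ := Ideal.mem_span_pair.mp h
    simp

/-- A quotient of `k[u, v]` in which one coordinate generates a truncated polynomial ring. -/
theorem exists_truncated_equiv {J : Ideal (MvPolynomial (Fin 2) k)} (w : Fin 2)
    (f : Fin 2 → Polynomial k) (n : ℕ) (hw : f w = Polynomial.X)
    (h1 : ∀ j, X j - Polynomial.aeval (X w) (f j) ∈ J) (h2 : X w ^ n ∈ J)
    (h3 : ∀ q ∈ J, aeval f q ∈ Ideal.span {(Polynomial.X : Polynomial k) ^ n}) :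
    Nonempty ((MvPolynomial (Fin 2) k ⧸ J) ≃+*
      (Polynomial k ⧸ Ideal.span {(Polynomial.X : Polynomial k) ^ n})) := by
  -- `ρ` and `σ` are inverse modulo the two ideals: `ρ ∘ σ` is the identity, and `σ ∘ ρ` is the
  -- identity modulo `J`.
  let ρ : MvPolynomial (Fin 2) k →ₐ[k] Polynomial k := aeval f
  let σ : Polynomial k →ₐ[k] MvPolynomial (Fin 2) k := Polynomial.aeval (X w)
  have hρσ : ∀ p, ρ (σ p) = p := by
    intro p
    have : ρ.comp σ = AlgHom.id k _ := by
      apply Polynomial.algHom_ext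
      simp [ρ, σ, hw]
    exact congr($this p)
  have hσρ : ∀ q, q - σ (ρ q) ∈ J := by
    intro q
    rw [← Ideal.Quotient.mk_eq_mk_iff_sub_mem]
    have : Ideal.Quotient.mkₐ k J = (Ideal.Quotient.mkₐ k J).comp (σ.comp ρ) := by
      apply MvPolynomial.algHom_ext
      intro j
      simp only [AlgHom.comp_apply, Ideal.Quotient.mkₐ_eq_mk, ρ, aeval_X]
      rw [Ideal.Quotient.mk_eq_mk_iff_sub_mem]
      exact h1 j
    exact congr($this q)
  have hle : J ≤ (Ideal.span {(Polynomial.X : Polynomial k) ^ n}).comap ρ.toRingHom := h3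
  refine ⟨RingEquiv.ofBijective (Ideal.quotientMap _ ρ.toRingHom hle) ⟨?_, ?_⟩⟩
  · apply Ideal.quotientMap_injective'
    intro q hq
    obtain ⟨c, hc⟩ := Ideal.mem_span_singleton.mp (show ρ q ∈ _ from hq)
    have h := hσρ q
    rw [hc, map_mul, map_pow] at h
    have hX : σ Polynomial.X = X w := Polynomial.aeval_X _
    rw [hX] at h
    have := add_mem h (Ideal.mul_mem_right (σ c) _ h2)
    rwa [sub_add_cancel] at this
  · exact Ideal.quotientMap_surjective fun p => ⟨σ p, hρσ p⟩

variable {b : Module.Basis (Fin 3) k (Fin 3 → k)} {I : (Plane k).IdealSheafData}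
  {J : Ideal (MvPolynomial (Fin 2) k)} {i : Fin 3}

/-- `I` is given on the `i`-th chart by the ideal `J` of `k[u, v]`. -/
def IsChartIdeal (b : Module.Basis (Fin 3) k (Fin 3 → k)) (I : (Plane k).IdealSheafData)
    (i : Fin 3) (J : Ideal (MvPolynomial (Fin 2) k)) : Prop :=
  I.ideal (chart b i) = J.map (chartIso b i : _ →+* _)

theorem apply_mem_map_ringEquiv_iff {R S : Type*} [CommRing R] [CommRing S] (e : R ≃+* S)
    (J : Ideal R) (q : R) : e q ∈ J.map (e : R →+* S) ↔ q ∈ J := by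
  refine ⟨fun hq => ?_, fun hq => Ideal.mem_map_of_mem (e : R →+* S) hq⟩
  obtain ⟨q', hq', he⟩ := (Ideal.mem_map_iff_of_surjective (e : R →+* S) e.surjective).mp hq
  rwa [← e.injective he]

theorem IsChartIdeal.mem_iff (h : IsChartIdeal b I i J) (q : MvPolynomial (Fin 2) k) :
    chartIso b i q ∈ I.ideal (chart b i) ↔ q ∈ J :=
  (iff_of_eq (congrArg (chartIso b i q ∈ ·) h)).trans
    (apply_mem_map_ringEquiv_iff (chartIso b i) J q)

theorem IsChartIdeal.exists_fat_point (h : IsChartIdeal b I i J) (w : Fin 2)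
    (f : Fin 2 → Polynomial k) (n : ℕ) (hn : n ≠ 0) (hw : f w = Polynomial.X)
    (h1 : ∀ j, X j - Polynomial.aeval (X w) (f j) ∈ J) (h2 : X w ^ n ∈ J)
    (h3 : ∀ q ∈ J, aeval f q ∈ Ideal.span {(Polynomial.X : Polynomial k) ^ n}) :
    ∃ x : I.subscheme, I.subschemeι x ∈ (chart b i).1 ∧
      (∀ y, I.subschemeι y ∈ (chart b i).1 → y = x) ∧ multiplicity I.subscheme x = n := by
  obtain ⟨e⟩ := exists_truncated_equiv w f n hw h1 h2 h3
  exact PlaneTangent.exists_fat_point I (chart b i) hn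
    ((Ideal.quotientEquiv J (I.ideal (chart b i)) (chartIso b i) h).symm.trans e)

theorem chartIso_X (j : Fin 2) : chartIso b i (X j) = ratio (b i) (b (i.succAbove j)) := by
  rw [← chartMap_affineCoord, affineCoord_succAbove]
  rfl

/-- A coordinate in the ideal vanishes on the subscheme, and it vanishes exactly off the other
chart. This separates points found on different charts. -/
theorem IsChartIdeal.notMem_chart (h : IsChartIdeal b I i J) {j : Fin 2} (hj : X j ∈ J)
    {x : I.subscheme} (hx : I.subschemeι x ∈ (chart b i).1) :
    I.subschemeι x ∉ (chart b (i.succAbove j)).1 := by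
  have hs : I.subschemeι x ∈ I.support := by
    have : I.subschemeι x ∈ Set.range I.subschemeι := ⟨x, rfl⟩
    rwa [I.range_subschemeι] at this
  rw [Scheme.IdealSheafData.mem_support_iff_of_mem hx, Scheme.mem_zeroLocus_iff] at hs
  have h2 := hs _ ((h.mem_iff (X j)).mpr hj)
  rw [chartIso_X] at h2
  rwa [mem_basicOpen_ratio hx] at h2

theorem IsChartIdeal.notMem_of_eq_top (h : IsChartIdeal b I i ⊤) (x : I.subscheme) :
    I.subschemeι x ∉ (chart b i).1 :=
  subschemeι_notMem_of_ideal_eq_top I _ (by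
    rw [h, Ideal.map_top]) x

theorem mem_zeroSet_iff {l : MvPolynomial (Fin 3) k} {x : Plane k} :
    x ∈ zeroSet l ↔ x ∉ Proj.basicOpen (grading k) l := by
  rw [Proj.mem_basicOpen, not_not]
  exact Set.singleton_subset_iff

/-- The chart ideal of a reduced closed subscheme that is given by coordinate equations. -/
theorem isChartIdeal_vanishingIdeal {Z : Closeds (Plane k)} (S : Set (Fin 2))
    (hrad : (Ideal.span (X '' S) : Ideal (MvPolynomial (Fin 2) k)).IsPrime)
    (hZ : ∀ x ∈ (chart b i).1, x ∈ Z ↔ ∀ j ∈ S, x ∉ (chart b (i.succAbove j)).1) :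
    IsChartIdeal b (Scheme.IdealSheafData.vanishingIdeal Z) i (Ideal.span (X '' S)) := by
  apply vanishingIdeal_ideal_eq
  · exact (Ideal.map_isPrime_of_equiv (chartIso b i) (I := Ideal.span (X '' S))).isRadical
  · intro x hx
    rw [hZ x hx, Ideal.map_span, Scheme.zeroLocus_span, Scheme.mem_zeroLocus_iff]
    simp only [Set.forall_mem_image]
    refine forall₂_congr fun j _ => not_congr ?_
    rw [← mem_basicOpen_ratio hx, ← chartIso_X]
    rfl

theorem isChartIdeal_vanishingIdeal_top {Z : Closeds (Plane k)}
    (hZ : ∀ x ∈ (chart b i).1, x ∉ Z) :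
    IsChartIdeal b (Scheme.IdealSheafData.vanishingIdeal Z) i ⊤ := by
  unfold IsChartIdeal
  rw [Ideal.map_top]
  refine vanishingIdeal_ideal_eq _ _ _ (by simp [Ideal.IsRadical]) fun x hx => ?_
  refine iff_of_false (hZ x hx) fun h => ?_
  rw [Scheme.mem_zeroLocus_iff] at h
  apply h 1 trivial
  simpa using hx

theorem isPrime_span_X (j : Fin 2) :
    (Ideal.span (X '' {j}) : Ideal (MvPolynomial (Fin 2) k)).IsPrime := by
  rw [Set.image_singleton, Ideal.span_singleton_prime (X_ne_zero j)]
  exact X_prime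

theorem isMaximal_span_X : (Ideal.span {X 0, X 1} : Ideal (MvPolynomial (Fin 2) k)).IsMaximal := by
  have : (Ideal.span {X 0, X 1} : Ideal (MvPolynomial (Fin 2) k)) =
      RingHom.ker (constantCoeff : MvPolynomial (Fin 2) k →+* k) := by
    ext q
    rw [RingHom.mem_ker, constantCoeff_eq_zero_iff]
  rw [this]
  exact RingHom.ker_isMaximal_of_surjective _ fun c => ⟨C c, constantCoeff_C _ c⟩

variable (b i) in
/-- The ideal of the origin of the `i`-th chart. -/
def originIdeal : Ideal Γ(Plane k, (chart b i).1) :=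
  RingHom.ker ((constantCoeff : MvPolynomial (Fin 2) k →+* k).comp
    ((chartIso b i).symm : _ →+* MvPolynomial (Fin 2) k))

instance isMaximal_originIdeal : (originIdeal b i).IsMaximal :=
  RingHom.ker_isMaximal_of_surjective _ fun c => ⟨chartIso b i (C c), by simp⟩

theorem chartIso_mem_originIdeal (q : MvPolynomial (Fin 2) k) :
    chartIso b i q ∈ originIdeal b i ↔ constantCoeff q = 0 := by
  simp [originIdeal, RingHom.mem_ker]

variable (b i) in
/-- The origin of the `i`-th chart. -/
def origin : Plane k :=
  (chart b i).2.fromSpec ⟨originIdeal b i, (isMaximal_originIdeal).isPrime⟩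

theorem origin_mem_chart : origin b i ∈ (chart b i).1 := by
  have hU : IsAffineOpen (chart b i).1 := (chart b i).2
  have : origin b i ∈ Set.range hU.fromSpec := ⟨_, rfl⟩
  rwa [hU.range_fromSpec] at this

/-- The charts cover the plane, so a point outside the other two lies in chart `i`; there its prime
contains both coordinates, hence equals the maximal ideal they generate. -/
theorem eq_origin_iff {x : Plane k} :
    x = origin b i ↔ ∀ j : Fin 2, x ∉ (chart b (i.succAbove j)).1 := by
  have hU : IsAffineOpen (chart b i).1 := (chart b i).2
  have key : ∀ z : PrimeSpectrum Γ(Plane k, (chart b i).1), ∀ j : Fin 2,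
      hU.fromSpec z ∈ (chart b (i.succAbove j)).1 ↔ chartIso b i (X j) ∉ z.asIdeal := by
    intro z j
    have hz : hU.fromSpec z ∈ (chart b i).1 := by
      have : hU.fromSpec z ∈ Set.range hU.fromSpec := ⟨z, rfl⟩
      rwa [hU.range_fromSpec] at this
    rw [← mem_basicOpen_ratio hz, ← chartIso_X, ← hU.fromSpec_image_basicOpen]
    constructor
    · rintro ⟨y, hy, hyz⟩
      have : y = z := hU.fromSpec.isOpenEmbedding.injective hyz
      subst this
      exact hy
    · intro h
      exact ⟨z, h, rfl⟩
  constructor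
  · rintro rfl j
    refine (key _ j).not.mpr (not_not.mpr ?_)
    exact (chartIso_mem_originIdeal _).mpr (constantCoeff_X _ j)
  · intro h
    obtain ⟨n, hn⟩ := exists_mem_basicOpen_basis b x
    have hxi : x ∈ (chart b i).1 := by
      rcases Fin.eq_self_or_eq_succAbove i n with rfl | ⟨j, rfl⟩
      · exact hn
      · exact absurd hn (h j)
    have : x ∈ Set.range hU.fromSpec := by rw [hU.range_fromSpec]; exact hxi
    obtain ⟨z, rfl⟩ := this
    have hz : originIdeal b i = z.asIdeal := by
      apply isMaximal_originIdeal.eq_of_le z.2.ne_top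
      intro a ha
      obtain ⟨q, rfl⟩ := (chartIso b i).surjective a
      rw [chartIso_mem_originIdeal, constantCoeff_eq_zero_iff] at ha
      obtain ⟨c, d, rfl⟩ := Ideal.mem_span_pair.mp ha
      rw [map_add, map_mul, map_mul]
      have h0 := not_not.mp ((key z 0).not.mp (h 0))
      have h1 := not_not.mp ((key z 1).not.mp (h 1))
      exact add_mem (Ideal.mul_mem_left _ _ h0) (Ideal.mul_mem_left _ _ h1)
    exact congrArg hU.fromSpec (PrimeSpectrum.ext hz.symm)

theorem isClosed_origin : IsClosed ({origin b i} : Set (Plane k)) := by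
  have : ({origin b i} : Set (Plane k)) = ⋂ j : Fin 2, ((chart b (i.succAbove j)).1 : Set _)ᶜ := by
    ext x
    rw [Set.mem_singleton_iff, eq_origin_iff]
    simp
  rw [this]
  exact isClosed_iInter fun j => (chart b (i.succAbove j)).1.isOpen.isClosed_compl

end ChartIdeals

/-! ### The three zero-dimensional types -/

section ZeroSchemes

open MvPolynomial

variable {k : Type u} [Field k] {s : TangentSection (planeToSpec k)}
  {T : Module.End k (Fin 3 → k)} {b : Module.Basis (Fin 3) k (Fin 3 → k)}
  {M : Matrix (Fin 3) (Fin 3) k} {I : (Plane k).IdealSheafData}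

theorem isChartIdeal_zeroIdeal (hs : IsVectorFieldOf s T)
    (hM : ∀ j, T (b j) = ∑ n, M n j • b n) (i : Fin 3) {c : Fin 2 → MvPolynomial (Fin 2) k}
    (hc : component M i = c) : IsChartIdeal b s.zeroIdeal i (Ideal.span {c 0, c 1}) := by
  have : c = ![c 0, c 1] := by ext1 j; fin_cases j <;> rfl
  have h := zeroIdeal_chart hs hM i
  rwa [hc, this, range_vecCons_pair] at h

/-- The derivation vanishes on affine opens, hence on every open set because sections of a sheaf are
determined locally. -/
theorem eq_zero_of_zeroIdeal_eq_bot (h : s.zeroIdeal = ⊥) : s = 0 := by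
  have haff : ∀ (U : (Plane k).affineOpens) (a : Γ(Plane k, U.1)), s.der U.1 a = 0 := by
    intro U a
    have h1 : s.der U.1 a ∈ s.zeroIdeal.ideal U := Ideal.subset_span ⟨a, rfl⟩
    rw [h] at h1
    exact h1
  apply TangentSection.ext
  funext U
  ext a
  change s.der U a = 0
  refine (Plane k).sheaf.eq_of_locally_eq' (fun V : {V : (Plane k).affineOpens // V.1 ≤ U} => V.1.1)
    U (fun V => homOfLE V.2) ?_ _ _ ?_
  · intro x hx
    obtain ⟨_, ⟨V, hV, rfl⟩, hxV, hVU⟩ := (Plane k).isBasis_affineOpens.exists_subset_of_mem_open hx U.2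
    exact Opens.mem_iSup.mpr ⟨⟨⟨V, hV⟩, hVU⟩, hxV⟩
  · intro V
    refine (s.der_restrict U V.1.1 V.2 a).symm.trans ((haff V.1 _).trans ?_)
    exact (map_zero ((Plane k).presheaf.map (homOfLE V.2).op).hom).symm

/-- For a scalar matrix each component is `c X_j - X_j c = 0`. This is what rules out a scalar `T`
when `s ≠ 0`. -/
theorem eq_zero_of_isVectorFieldOf_scalar (hs : IsVectorFieldOf s T) {c : k}
    (hT : ∀ v, T v = c • v) : s = 0 := by
  apply eq_zero_of_zeroIdeal_eq_bot
  let b := Pi.basisFun k (Fin 3)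
  have hM : ∀ j, T (b j) = ∑ n, (Matrix.diagonal fun _ => c) n j • b n := by
    intro j
    simp [hT, Matrix.diagonal_apply]
  apply Scheme.IdealSheafData.ext_of_iSup_eq_top (chart b) (iSup_chart b)
  intro i
  rw [zeroIdeal_chart hs hM i]
  have : component (Matrix.diagonal fun _ => c) i = 0 := by
    funext j
    fin_cases i
    · simp only [Fin.zero_eta]
      rw [component_zero]
      fin_cases j <;> simp [mul_comm]
    · simp only [Fin.mk_one]
      rw [component_one]
      fin_cases j <;> simp [mul_comm]
    · simp only [Fin.reduceFinMk]
      rw [component_two]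
      fin_cases j <;> simp [mul_comm]
  rw [this]
  simp

theorem exists_mem_chart (b : Module.Basis (Fin 3) k (Fin 3 → k)) (x : Plane k) :
    x ∈ (chart b 0).1 ∨ x ∈ (chart b 1).1 ∨ x ∈ (chart b 2).1 := by
  obtain ⟨i, hi⟩ := exists_mem_basicOpen_basis b x
  fin_cases i
  · exact Or.inl hi
  · exact Or.inr (Or.inl hi)
  · exact Or.inr (Or.inr hi)

theorem span_C_mul_pair {R : Type*} [CommRing R] {c d : R} (hc : IsUnit c) (hd : IsUnit d)
    (x y : R) : Ideal.span {c * x, d * y} = Ideal.span {x, y} := by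
  rw [Ideal.span_pair_comm, Ideal.span_insert, Ideal.span_insert]
  rw [Ideal.span_singleton_mul_left_unit hc, Ideal.span_singleton_mul_left_unit hd, sup_comm]

theorem IsChartIdeal.exists_reduced_origin {i : Fin 3}
    (h : IsChartIdeal b I i (Ideal.span {X 0, X 1})) :
    ∃ x : I.subscheme, I.subschemeι x ∈ (chart b i).1 ∧
      (∀ y, I.subschemeι y ∈ (chart b i).1 → y = x) ∧ multiplicity I.subscheme x = 1 := by
  have h0 : (X 0 : MvPolynomial (Fin 2) k) ∈ Ideal.span {X 0, X 1} :=
    Ideal.subset_span (by simp)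
  have h1 : (X 1 : MvPolynomial (Fin 2) k) ∈ Ideal.span {X 0, X 1} :=
    Ideal.subset_span (by simp)
  refine h.exists_fat_point 0 ![Polynomial.X, 0] 1 one_ne_zero rfl ?_ (by simpa using h0) ?_
  · intro j; fin_cases j
    · simp
    · simpa using h1
  · intro q hq
    obtain ⟨c, d, rfl⟩ := Ideal.mem_span_pair.mp hq
    simp [Ideal.mem_span_singleton]

theorem isThreePoints_of_chartIdeals
    (h : ∀ i, IsChartIdeal b I i (Ideal.span {X 0, X 1})) : IsThreePoints I.subscheme := by
  have hX : ∀ j, (X j : MvPolynomial (Fin 2) k) ∈ Ideal.span {X 0, X 1} := fun j =>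
    Ideal.subset_span (by fin_cases j <;> simp)
  obtain ⟨p, hp, hp', hpm⟩ := (h 0).exists_reduced_origin
  obtain ⟨q, hq, hq', hqm⟩ := (h 1).exists_reduced_origin
  obtain ⟨r, hr, hr', hrm⟩ := (h 2).exists_reduced_origin
  refine ⟨p, q, r, ?_, ?_, ?_, ?_, hpm, hqm, hrm⟩
  · rintro rfl
    exact (h 0).notMem_chart (hX 0) hp hq
  · rintro rfl
    exact (h 0).notMem_chart (hX 1) hp hr
  · rintro rfl
    exact (h 1).notMem_chart (hX 1) hq hr
  · intro x
    rcases exists_mem_chart b (I.subschemeι x) with hx | hx | hx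
    · exact Or.inl (hp' x hx)
    · exact Or.inr (Or.inl (hq' x hx))
    · exact Or.inr (Or.inr (hr' x hx))

theorem isThreePoints_zeroScheme (hs : IsVectorFieldOf s T) {x y z : k} (hxy : x ≠ y)
    (hxz : x ≠ z) (hyz : y ≠ z) (h0 : T (b 0) = x • b 0) (h1 : T (b 1) = y • b 1)
    (h2 : T (b 2) = z • b 2) : IsThreePoints s.zeroScheme := by
  have hM : ∀ j, T (b j) = ∑ n, !![x, 0, 0; 0, y, 0; 0, 0, z] n j • b n := by
    intro j; fin_cases j <;> simp [Fin.sum_univ_three, h0, h1, h2]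
  have hu : ∀ {a c : k}, a ≠ c → IsUnit (C (a - c) : MvPolynomial (Fin 2) k) := fun hac =>
    (sub_ne_zero.mpr hac).isUnit.map C
  apply isThreePoints_of_chartIdeals (b := b)
  intro i
  fin_cases i
  · rw [← span_C_mul_pair (hu hxy.symm) (hu hxz.symm)]
    refine isChartIdeal_zeroIdeal hs hM 0 (c := ![C (y - x) * X 0, C (z - x) * X 1]) ?_
    rw [component_zero]
    funext j; fin_cases j <;> simp <;> ring
  · rw [← span_C_mul_pair (hu hxy) (hu hyz.symm)]
    refine isChartIdeal_zeroIdeal hs hM 1 (c := ![C (x - y) * X 0, C (z - y) * X 1]) ?_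
    rw [component_one]
    funext j; fin_cases j <;> simp <;> ring
  · rw [← span_C_mul_pair (hu hxz) (hu hyz)]
    refine isChartIdeal_zeroIdeal hs hM 2 (c := ![C (x - z) * X 0, C (y - z) * X 1]) ?_
    rw [component_two]
    funext j; fin_cases j <;> simp <;> ring

theorem isDoubleAndSimplePoint_zeroScheme (hs : IsVectorFieldOf s T) {x y : k} (hxy : x ≠ y)
    (h0 : T (b 0) = x • b 0) (h1 : T (b 1) = x • b 1 + b 0)
    (h2 : T (b 2) = y • b 2) : IsDoubleAndSimplePoint s.zeroScheme := by
  have hM : ∀ j, T (b j) = ∑ n, !![x, 1, 0; 0, x, 0; 0, 0, y] n j • b n := by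
    intro j; fin_cases j <;> simp [Fin.sum_univ_three, h0, h1, h2, add_comm]
  have hd : y - x ≠ 0 := sub_ne_zero.mpr hxy.symm
  have hCd : (C (y - x)⁻¹ * C (y - x) : MvPolynomial (Fin 2) k) = 1 := by
    rw [← C_mul, inv_mul_cancel₀ hd, C_1]
  have c0 : IsChartIdeal b s.zeroIdeal 0 ⊤ := by
    have := isChartIdeal_zeroIdeal hs hM 0 (c := ![1, C (y - x) * X 1]) (by
      rw [component_zero]
      funext j; fin_cases j <;> simp <;> ring)
    rwa [Ideal.eq_top_of_isUnit_mem _ (Ideal.subset_span (by simp)) isUnit_one] at this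
  have c1 : IsChartIdeal b s.zeroIdeal 1 (Ideal.span {- X 0 ^ 2, X 1 * (C (y - x) - X 0)}) :=
    isChartIdeal_zeroIdeal hs hM 1 (c := ![- X 0 ^ 2, X 1 * (C (y - x) - X 0)]) (by
      rw [component_one]
      funext j; fin_cases j <;> simp <;> ring)
  have c2 : IsChartIdeal b s.zeroIdeal 2 (Ideal.span {X 0, X 1}) := by
    have := isChartIdeal_zeroIdeal hs hM 2 (c := ![- C (y - x) * X 0, X 0 - C (y - x) * X 1]) (by
      rw [component_two]
      funext j; fin_cases j <;> simp <;> ring)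
    convert this using 1
    apply le_antisymm <;> rw [Ideal.span_le, Set.insert_subset_iff, Set.singleton_subset_iff] <;>
      refine ⟨Ideal.mem_span_pair.mpr ?_, Ideal.mem_span_pair.mpr ?_⟩
    · refine ⟨- C (y - x)⁻¹, 0, ?_⟩
      simp only [Matrix.cons_val_zero, Matrix.cons_val_one]
      linear_combination X 0 * hCd
    · refine ⟨- C (y - x)⁻¹ * C (y - x)⁻¹, - C (y - x)⁻¹, ?_⟩
      simp only [Matrix.cons_val_zero, Matrix.cons_val_one]
      linear_combination (X 0 * C (y - x)⁻¹ + X 1) * hCd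
    · exact ⟨- C (y - x), 0, by simp⟩
    · exact ⟨1, - C (y - x), by simp; ring⟩
  obtain ⟨p, hp, hp', hpm⟩ := c1.exists_fat_point 0 ![Polynomial.X, 0] 2 two_ne_zero rfl (by
      intro j; fin_cases j
      · simp
      -- With `d = y - x`, the inverse of `d - X₀` modulo `X₀²` is `d⁻² (d + X₀)`; hence `X₁` lies
      -- in the ideal.
      · refine Ideal.mem_span_pair.mpr ⟨- X 1 * C (y - x)⁻¹ * C (y - x)⁻¹,
          C (y - x)⁻¹ * C (y - x)⁻¹ * (C (y - x) + X 0), ?_⟩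
        simp only [Fin.mk_one, Matrix.cons_val_one, Matrix.cons_val_zero, map_zero]
        linear_combination (X 1 * C (y - x)⁻¹ * C (y - x) + X 1) * hCd)
    (Ideal.mem_span_pair.mpr ⟨-1, 0, by ring⟩) (by
      intro q hq
      obtain ⟨c, d, rfl⟩ := Ideal.mem_span_pair.mp hq
      simp [Ideal.mem_span_singleton])
  obtain ⟨q, hq, hq', hqm⟩ := c2.exists_reduced_origin
  refine ⟨p, q, ?_, ?_, hpm, hqm⟩
  · rintro rfl
    -- The two points differ because their multiplicities do.
    have := hpm.symm.trans hqm
    norm_num at this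
  · intro w
    rcases exists_mem_chart b (s.zeroIdeal.subschemeι w) with hx | hx | hx
    · exact absurd hx (c0.notMem_of_eq_top w)
    · exact Or.inl (hp' w hx)
    · exact Or.inr (hq' w hx)

theorem isTriplePoint_zeroScheme (hs : IsVectorFieldOf s T) {x : k}
    (h0 : T (b 0) = x • b 0) (h1 : T (b 1) = x • b 1 + b 0)
    (h2 : T (b 2) = x • b 2 + b 1) : IsTriplePoint s.zeroScheme := by
  have hM : ∀ j, T (b j) = ∑ n, !![x, 1, 0; 0, x, 1; 0, 0, x] n j • b n := by
    intro j; fin_cases j <;> simp [Fin.sum_univ_three, h0, h1, h2, add_comm]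
  have c0 : IsChartIdeal b s.zeroIdeal 0 ⊤ := by
    have := isChartIdeal_zeroIdeal hs hM 0 (c := ![1, X 0]) (by
      rw [component_zero]
      funext j; fin_cases j <;> simp <;> ring)
    rwa [Ideal.eq_top_of_isUnit_mem _ (Ideal.subset_span (by simp)) isUnit_one] at this
  have c1 : IsChartIdeal b s.zeroIdeal 1 ⊤ := by
    have := isChartIdeal_zeroIdeal hs hM 1 (c := ![- X 0 ^ 2, 1 - X 0 * X 1]) (by
      rw [component_one]
      funext j; fin_cases j <;> simp <;> ring)
    -- The identity `(1 - X₀X₁)(1 + X₀X₁) + X₀²X₁² = 1` shows that there is no zero on this chart.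
    rwa [Ideal.eq_top_of_isUnit_mem _ (Ideal.mem_span_pair.mpr ⟨- X 1 ^ 2, 1 + X 0 * X 1, by
      simp only [Matrix.cons_val_zero, Matrix.cons_val_one]; ring⟩) isUnit_one] at this
  have c2 : IsChartIdeal b s.zeroIdeal 2 (Ideal.span {- X 0 * X 1, X 0 - X 1 ^ 2}) :=
    isChartIdeal_zeroIdeal hs hM 2 (c := ![- X 0 * X 1, X 0 - X 1 ^ 2]) (by
      rw [component_two]
      funext j; fin_cases j <;> simp <;> ring)
  -- Eliminating `X₀ = X₁²` turns `X₀X₁ = 0` into `X₁³ = 0`, so `X₁` generates the quotient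
  -- `k[t]/(t³)`.
  obtain ⟨p, -, hp', hpm⟩ := c2.exists_fat_point 1 ![Polynomial.X ^ 2, Polynomial.X] 3
    three_ne_zero rfl (by
      intro j; fin_cases j
      · exact Ideal.subset_span (by simp)
      · simp)
    (Ideal.mem_span_pair.mpr ⟨-1, - X 1, by ring⟩) (by
      intro q hq
      obtain ⟨c, d, rfl⟩ := Ideal.mem_span_pair.mp hq
      refine Ideal.mem_span_singleton.mpr ⟨- aeval ![Polynomial.X ^ 2, Polynomial.X] c, ?_⟩
      simp
      ring)
  refine ⟨p, ?_, hpm⟩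
  intro w
  rcases exists_mem_chart b (s.zeroIdeal.subschemeι w) with hx | hx | hx
  · exact absurd hx (c0.notMem_of_eq_top w)
  · exact absurd hx (c1.notMem_of_eq_top w)
  · exact hp' w hx

end ZeroSchemes

/-! ### The two types containing a line -/

section ZeroSchemesWithLine

open MvPolynomial Scheme.IdealSheafData

variable {k : Type u} [Field k] {s : TangentSection (planeToSpec k)}
  {T : Module.End k (Fin 3 → k)} {b : Module.Basis (Fin 3) k (Fin 3 → k)}
  {I I' : (Plane k).IdealSheafData} {i : Fin 3} {J J' : Ideal (MvPolynomial (Fin 2) k)}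

theorem isLine_zeroSet_lin (b : Module.Basis (Fin 3) k (Fin 3 → k)) (i : Fin 3) :
    IsLine (zeroSet (lin (b i))) :=
  ⟨lin (b i), lin_mem _, lin_ne_zero (b.ne_zero i), rfl⟩

theorem isChartIdeal_line (i : Fin 3) (j : Fin 2) :
    IsChartIdeal b (vanishingIdeal (zeroSet (lin (b (i.succAbove j))))) i (Ideal.span {X j}) := by
  have := isChartIdeal_vanishingIdeal (b := b) (i := i)
    (Z := zeroSet (lin (b (i.succAbove j)))) {j} (isPrime_span_X j) (fun x _ => by
      rw [mem_zeroSet_iff]; simp)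
  rwa [Set.image_singleton] at this

theorem isChartIdeal_line_self (i : Fin 3) :
    IsChartIdeal b (vanishingIdeal (zeroSet (lin (b i)))) i ⊤ :=
  isChartIdeal_vanishingIdeal_top fun _ hx h => mem_zeroSet_iff.mp h hx

theorem isChartIdeal_origin (i : Fin 3) :
    IsChartIdeal b (vanishingIdeal ⟨{origin b i}, isClosed_origin⟩) i
      (Ideal.span {X 0, X 1}) := by
  have h : (X '' Set.univ : Set (MvPolynomial (Fin 2) k)) = {X 0, X 1} := by
    ext q; simp [eq_comm]
  have := isChartIdeal_vanishingIdeal (b := b) (i := i)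
    (Z := ⟨{origin b i}, isClosed_origin⟩) Set.univ (by
      rw [h]; exact isMaximal_span_X.isPrime) (fun x _ => by
      simp only [Set.mem_univ, true_imp_iff]
      exact eq_origin_iff)
  rwa [h] at this

theorem isChartIdeal_origin_succAbove (i : Fin 3) (j : Fin 2) :
    IsChartIdeal b (vanishingIdeal ⟨{origin b i}, isClosed_origin⟩) (i.succAbove j) ⊤ :=
  isChartIdeal_vanishingIdeal_top fun _ hx h => eq_origin_iff.mp h j hx

theorem IsChartIdeal.ideal_eq (h : IsChartIdeal b I i J) (h' : IsChartIdeal b I' i J) :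
    I.ideal (chart b i) = I'.ideal (chart b i) :=
  Eq.trans h (Eq.symm h')

theorem IsChartIdeal.inf_top (h : IsChartIdeal b I i J) (h' : IsChartIdeal b I' i ⊤) :
    IsChartIdeal b (I ⊓ I') i J := by
  have h1 : I'.ideal (chart b i) = ⊤ := Eq.trans h' (Ideal.map_top _)
  refine Eq.trans ?_ h
  rw [ideal_inf, Pi.inf_apply, h1, inf_top_eq]

theorem IsChartIdeal.top_inf (h : IsChartIdeal b I i ⊤) (h' : IsChartIdeal b I' i J) :
    IsChartIdeal b (I ⊓ I') i J :=
  inf_comm I' I ▸ h'.inf_top h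

theorem isLineUnionPoint_zeroIdeal (hs : IsVectorFieldOf s T) {x y : k} (hxy : x ≠ y)
    (h0 : T (b 0) = x • b 0) (h1 : T (b 1) = x • b 1) (h2 : T (b 2) = y • b 2) :
    IsLineUnionPoint s.zeroIdeal := by
  have hM : ∀ j, T (b j) = ∑ n, !![x, 0, 0; 0, x, 0; 0, 0, y] n j • b n := by
    intro j; fin_cases j <;> simp [Fin.sum_univ_three, h0, h1, h2]
  have hu : ∀ {a c : k}, a ≠ c → IsUnit (C (a - c) : MvPolynomial (Fin 2) k) := fun hac =>
    (sub_ne_zero.mpr hac).isUnit.map C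
  have hspan : (Ideal.span {0, C (y - x) * X 1} : Ideal (MvPolynomial (Fin 2) k)) =
      Ideal.span {X 1} := by
    rw [Ideal.span_insert_zero, Ideal.span_singleton_mul_left_unit (hu hxy.symm)]
  have c0 : IsChartIdeal b s.zeroIdeal 0 (Ideal.span {X 1}) := by
    rw [← hspan]
    refine isChartIdeal_zeroIdeal hs hM 0 (c := ![0, C (y - x) * X 1]) ?_
    rw [component_zero]
    funext j; fin_cases j <;> simp <;> ring
  have c1 : IsChartIdeal b s.zeroIdeal 1 (Ideal.span {X 1}) := by
    rw [← hspan]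
    refine isChartIdeal_zeroIdeal hs hM 1 (c := ![0, C (y - x) * X 1]) ?_
    rw [component_one]
    funext j; fin_cases j <;> simp <;> ring
  have c2 : IsChartIdeal b s.zeroIdeal 2 (Ideal.span {X 0, X 1}) := by
    rw [← span_C_mul_pair (hu hxy) (hu hxy)]
    refine isChartIdeal_zeroIdeal hs hM 2 (c := ![C (x - y) * X 0, C (x - y) * X 1]) ?_
    rw [component_two]
    funext j; fin_cases j <;> simp <;> ring
  refine ⟨zeroSet (lin (b 2)), origin b 2, isClosed_origin, isLine_zeroSet_lin b 2, ?_, ?_⟩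
  · rw [mem_zeroSet_iff, not_not]
    exact origin_mem_chart
  · apply ext_of_iSup_eq_top (chart b) (iSup_chart b)
    intro i
    fin_cases i
    -- The point is absent from charts `0` and `1` and the line from chart `2`, so on each chart one
    -- ideal of the intersection is the unit ideal.
    · exact c0.ideal_eq ((isChartIdeal_line 0 1).inf_top (isChartIdeal_origin_succAbove 2 0))
    · exact c1.ideal_eq ((isChartIdeal_line 1 1).inf_top (isChartIdeal_origin_succAbove 2 1))
    · exact c2.ideal_eq ((isChartIdeal_line_self 2).top_inf (isChartIdeal_origin 2))

/-- The quotient `(v) ⧸ A` is nonzero, generated by `v` and killed by `m`, hence isomorphic to the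
simple module `R ⧸ m`. -/
theorem covBy_span_singleton {R : Type*} [CommRing R] {A m : Ideal R} {v : R} (hm : m.IsMaximal)
    (hA : A ≤ Ideal.span {v}) (hv : v ∉ A) (hmv : ∀ a ∈ m, a * v ∈ A) :
    A ⋖ Ideal.span {v} := by
  refine ⟨lt_of_le_of_ne hA fun h => hv (h ▸ Ideal.mem_span_singleton_self v), ?_⟩
  intro B hAB hB
  obtain ⟨c, hcB, hcA⟩ := SetLike.exists_of_lt hAB
  obtain ⟨r, rfl⟩ := Ideal.mem_span_singleton'.mp (hB.le hcB)
  obtain ⟨t, a, ha, hta⟩ := hm.exists_inv fun hr => hcA (hmv r hr)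
  refine hB.not_ge ((Ideal.span_singleton_le_iff_mem _).mpr ?_)
  have : v = t * (r * v) + a * v := by linear_combination (-v) * hta
  rw [this]
  exact add_mem (Ideal.mul_mem_left _ _ hcB) (hAB.le (hmv a ha))

theorem length_quotient_eq_one_of_covBy {R : Type*} [CommRing R] {A B : Ideal R} (h : A ⋖ B) :
    Module.length R (B ⧸ A.submoduleOf B) = 1 :=
  Module.length_eq_one_iff.mpr ((covBy_iff_quot_is_simple h.le).mp h)

/-- The annihilator of `X₁` modulo `(X₀X₁, X₁²)` is the maximal ideal of the origin. This yields
both the associated prime and the length one. -/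
theorem mul_X_one_mem_iff (q : MvPolynomial (Fin 2) k) :
    q * X 1 ∈ (Ideal.span {- X 0 * X 1, - X 1 ^ 2} : Ideal (MvPolynomial (Fin 2) k)) ↔
      constantCoeff q = 0 := by
  rw [constantCoeff_eq_zero_iff, Ideal.mem_span_pair, Ideal.mem_span_pair]
  constructor
  · rintro ⟨c, d, h⟩
    refine ⟨-c, -d, mul_right_cancel₀ (X_ne_zero (R := k) (1 : Fin 2)) ?_⟩
    linear_combination h
  · rintro ⟨c, d, rfl⟩
    exact ⟨-c, -d, by ring⟩

theorem X_one_dvd_of_mem {q : MvPolynomial (Fin 2) k}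
    (hq : q ∈ (Ideal.span {- X 0 * X 1, - X 1 ^ 2} : Ideal (MvPolynomial (Fin 2) k))) :
    X 1 ∣ q := by
  obtain ⟨c, d, rfl⟩ := Ideal.mem_span_pair.mp hq
  exact ⟨- c * X 0 - d * X 1, by ring⟩

theorem constantCoeff_eq_zero_of_X_dvd {q : MvPolynomial (Fin 2) k} {j : Fin 2} (h : X j ∣ q) :
    constantCoeff q = 0 := by
  obtain ⟨c, rfl⟩ := h
  simp

theorem IsChartIdeal.exists_isEmbeddedPoint
    (h : IsChartIdeal b I i (Ideal.span {- X 0 * X 1, - X 1 ^ 2})) :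
    ∃ x : I.subscheme, I.subschemeι x = origin b i ∧ IsEmbeddedPoint I.subscheme x := by
  let φ : Γ(Plane k, (chart b i).1) →+* k := (constantCoeff : MvPolynomial (Fin 2) k →+* k).comp
    ((chartIso b i).symm : _ →+* MvPolynomial (Fin 2) k)
  have hφ : ∀ a ∈ I.ideal (chart b i), φ a = 0 := by
    intro a ha
    obtain ⟨q, rfl⟩ := (chartIso b i).surjective a
    exact (chartIso_mem_originIdeal q).mpr
      (constantCoeff_eq_zero_of_X_dvd (X_one_dvd_of_mem ((h.mem_iff q).mp ha)))
  let ψ := Ideal.Quotient.lift (I.ideal (chart b i)) φ hφ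
  let π : MvPolynomial (Fin 2) k →+* Γ(Plane k, (chart b i).1) ⧸ I.ideal (chart b i) :=
    (Ideal.Quotient.mk _).comp (chartIso b i : _ →+* Γ(Plane k, (chart b i).1))
  have hπ : Function.Surjective π :=
    Ideal.Quotient.mk_surjective.comp (chartIso b i).surjective
  have hπ0 : ∀ q, π q = 0 ↔ q ∈ Ideal.span {- X 0 * X 1, - X 1 ^ 2} := fun q =>
    Ideal.Quotient.eq_zero_iff_mem.trans (h.mem_iff q)
  have hker : ∀ q, π q ∈ RingHom.ker ψ ↔ constantCoeff q = 0 := fun q =>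
    chartIso_mem_originIdeal q
  let y : PrimeSpectrum (Γ(Plane k, (chart b i).1) ⧸ I.ideal (chart b i)) :=
    ⟨RingHom.ker ψ, RingHom.ker_isPrime ψ⟩
  refine ⟨I.subschemeCover.f (chart b i) y, ?_, ?_⟩
  · rw [subschemeι_subschemeCover]
    rfl
  -- `X₁` is the element killed by the maximal ideal. `X₀` is a parameter along the line `X₁ = 0`,
  -- so it is not nilpotent.
  · refine isEmbeddedPoint_of_localization I (chart b i) y (π (X 0)) (π (X 1)) ?_ ?_ ?_ ?_
    · intro a ha
      obtain ⟨q, rfl⟩ := hπ a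
      rw [← map_mul, hπ0, mul_X_one_mem_iff]
      exact (hker q).mp ha
    · intro a ha
      obtain ⟨q, rfl⟩ := hπ a
      rw [← map_mul, Ne, hπ0, mul_X_one_mem_iff]
      exact (hker q).not.mp ha
    · exact (hker _).mpr (constantCoeff_X _ 0)
    · intro a ha n
      obtain ⟨q, rfl⟩ := hπ a
      rw [← map_pow, ← map_mul, Ne, hπ0]
      intro hq
      rcases X_prime.dvd_or_dvd (X_one_dvd_of_mem hq) with hd | hd
      · exact ha ((hker q).mpr (constantCoeff_eq_zero_of_X_dvd hd))
      · have := X_prime.dvd_of_dvd_pow hd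
        rw [X_dvd_X] at this
        simp at this

theorem isLineWithEmbeddedPoint_zeroIdeal (hs : IsVectorFieldOf s T) {x : k}
    (h0 : T (b 0) = x • b 0) (h1 : T (b 1) = x • b 1) (h2 : T (b 2) = x • b 2 + b 1) :
    IsLineWithEmbeddedPoint s.zeroIdeal := by
  have hM : ∀ j, T (b j) = ∑ n, !![x, 0, 0; 0, x, 1; 0, 0, x] n j • b n := by
    intro j; fin_cases j <;> simp [Fin.sum_univ_three, h0, h1, h2, add_comm]
  have c0 : IsChartIdeal b s.zeroIdeal 0 (Ideal.span {X 0}) := by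
    rw [← Ideal.span_insert_zero]
    refine isChartIdeal_zeroIdeal hs hM 0 (c := ![0, X 0]) ?_
    rw [component_zero]
    funext j; fin_cases j <;> simp <;> ring
  have c1 : IsChartIdeal b s.zeroIdeal 1 ⊤ := by
    have := isChartIdeal_zeroIdeal hs hM 1 (c := ![0, 1]) (by
      rw [component_one]
      funext j; fin_cases j <;> simp <;> ring)
    rwa [Ideal.eq_top_of_isUnit_mem _ (Ideal.subset_span (by simp)) isUnit_one] at this
  have c2 : IsChartIdeal b s.zeroIdeal 2 (Ideal.span {- X 0 * X 1, - X 1 ^ 2}) := by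
    refine isChartIdeal_zeroIdeal hs hM 2 (c := ![- X 0 * X 1, - X 1 ^ 2]) ?_
    rw [component_two]
    funext j; fin_cases j <;> simp <;> ring
  have l0 : IsChartIdeal b (vanishingIdeal (zeroSet (lin (b 1)))) 0 (Ideal.span {X 0}) :=
    isChartIdeal_line 0 0
  have l1 : IsChartIdeal b (vanishingIdeal (zeroSet (lin (b 1)))) 1 ⊤ := isChartIdeal_line_self 1
  have l2 : IsChartIdeal b (vanishingIdeal (zeroSet (lin (b 1)))) 2 (Ideal.span {X 1}) :=
    isChartIdeal_line 2 1
  have hle : s.zeroIdeal ≤ vanishingIdeal (zeroSet (lin (b 1))) := by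
    apply le_of_iSup_eq_top (chart b) (iSup_chart b)
    intro i
    fin_cases i
    · exact (c0.ideal_eq l0).le
    · exact (c1.ideal_eq l1).le
    · intro a ha
      obtain ⟨q, rfl⟩ := (chartIso b 2).surjective a
      exact (l2.mem_iff q).mpr (Ideal.mem_span_singleton.mpr (X_one_dvd_of_mem ((c2.mem_iff q).mp ha)))
  have haway : ∀ U : (Plane k).affineOpens, origin b 2 ∉ U.1 →
      s.zeroIdeal.ideal U = (vanishingIdeal (zeroSet (lin (b 1)))).ideal U := by
    intro U hU
    apply ideal_eq_of_local
    intro z hz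
    by_cases hz0 : z ∈ (chart b 0).1
    · exact ⟨_, hz0, c0.ideal_eq l0⟩
    by_cases hz1 : z ∈ (chart b 1).1
    · exact ⟨_, hz1, c1.ideal_eq l1⟩
    -- The only point outside charts `0` and `1` is the origin of chart `2`, which `U` omits.
    refine absurd (eq_origin_iff.mpr fun j => ?_) fun h => hU (h ▸ hz)
    fin_cases j
    · exact hz0
    · exact hz1
  have hcov : s.zeroIdeal.ideal (chart b 2) ⋖
      (vanishingIdeal (zeroSet (lin (b 1)))).ideal (chart b 2) := by
    have hl : (vanishingIdeal (zeroSet (lin (b 1)))).ideal (chart b 2) =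
        Ideal.span {chartIso b 2 (X 1)} := by
      refine Eq.trans l2 ?_
      rw [Ideal.map_span, Set.image_singleton]
      rfl
    rw [hl]
    refine covBy_span_singleton (isMaximal_originIdeal (b := b) (i := 2)) (hl ▸ hle _) ?_ ?_
    · intro h
      have := (mul_X_one_mem_iff (k := k) 1).mp (by rw [one_mul]; exact (c2.mem_iff _).mp h)
      simp at this
    · intro a ha
      obtain ⟨q, rfl⟩ := (chartIso b 2).surjective a
      rw [← map_mul]
      exact (c2.mem_iff _).mpr ((mul_X_one_mem_iff q).mpr ((chartIso_mem_originIdeal q).mp ha))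
  refine ⟨zeroSet (lin (b 1)), origin b 2, isLine_zeroSet_lin b 1, isClosed_origin, ?_, hle, haway,
    c2.exists_isEmbeddedPoint, fun U hU => ?_⟩
  · exact mem_zeroSet_iff.mpr ((eq_origin_iff (b := b) (i := 2)).mp rfl 1)
  · have hU' := covBy_of_covBy hle isClosed_origin haway (origin_mem_chart (b := b) (i := 2)) hU hcov
    exact length_quotient_eq_one_of_covBy hU'

end ZeroSchemesWithLine

end PlaneTangent

end

/-! ### The classification -/

open PlaneTangent in
theorem theorem2 {k : Type u} [Field k] [IsAlgClosed k]
    (s : TangentSection (planeToSpec k)) (hs : s ≠ 0) :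
    IsThreePoints s.zeroScheme ∨
      IsDoubleAndSimplePoint s.zeroScheme ∨
      IsTriplePoint s.zeroScheme ∨
      IsLineUnionPoint s.zeroIdeal ∨
      IsLineWithEmbeddedPoint s.zeroIdeal := by
  obtain ⟨T, hT⟩ := exists_endomorphism s
  have hT' : IsVectorFieldOf s T := hT
  obtain ⟨b, hb⟩ := exists_jordan_basis (by simp) T fun ⟨_, hc⟩ =>
    hs (eq_zero_of_isVectorFieldOf_scalar hT' hc)
  rcases hb with ⟨x, y, z, hxy, hxz, hyz, h0, h1, h2⟩ | ⟨x, y, hxy, h0, h1, h2⟩ | ⟨x, h0, h1, h2⟩ |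
    ⟨x, y, hxy, h0, h1, h2⟩ | ⟨x, h0, h1, h2⟩
  · exact Or.inl (isThreePoints_zeroScheme hT' hxy hxz hyz h0 h1 h2)
  · exact Or.inr (Or.inl (isDoubleAndSimplePoint_zeroScheme hT' hxy h0 h1 h2))
  · exact Or.inr (Or.inr (Or.inl (isTriplePoint_zeroScheme hT' h0 h1 h2)))
  · exact Or.inr (Or.inr (Or.inr (Or.inl (isLineUnionPoint_zeroIdeal hT' hxy h0 h1 h2))))
  · exact Or.inr (Or.inr (Or.inr (Or.inr (isLineWithEmbeddedPoint_zeroIdeal hT' h0 h1 h2))))
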